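/- **Setting.** Let $A$ be an order unit space (an archimedean partially ordered real vector space with order unit $1$) that is complete in its order unit norm $\|a\|=\inf\{\lambda\ge 0: -\lambda 1\le a\le\lambda 1\}$, and let $E=\{e\in A: 0\le e\le 1\}$. A *compression with focus* $p\in E$ is a positive linear map $J:A\to A$ with $J(1)=p$ such that for all $e\in E$: $e\le p$ implies $J(e)=e$, and $J(e)=0$ implies $e\le 1-p$. A *compression base* is a family $(J_p)_{p\in P}$ of compressions indexed by their foci such that - $P\subseteq E$ contains $0,1$, is closed under $p\mapsto 1-p$ and under those sums $p+q$ with $p+q\le 1$, and is normal: if $d,e,f\in E$, $d+e+f\le 1$ and $d+e,d+f\in P$, then $d\in P$; - $J_{p+r}\circ J_{q+r}=J_r$ whenever $p,q,r\in P$ and $p+q+r\le 1$. For $p\in P$ let $C(p)=\{a\in A: a=J_p(a)+J_{1-p}(a)\}$; for $S\subseteq A$ let $PC(S)=\{p\in P: S\subseteq C(p)\}$; for $a\in A$ let $P(a)=PC(PC(\{a\})\cup\{a\})$. The base is *spectral* if - (projection cover) for every $e\in E$ there is $p\in P$ such that for all $q\in P$: $e\le q\iff p\le q$; - (comparability) for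 every $a\in A$ there is $p\in P(a)$ with $J_{1-p}(a)\le 0\le J_p(a)$. Elements $p,q\in E$ are compatible if $p=c+p_1$ and $q=c+q_1$ for some $c,p_1,q_1\in E$ with $c+p_1+q_1\in E$. Elements $a,b\in A$ *commute* if all $p\in P(a)$ and $q\in P(b)$ are compatible. For $S\subseteq A$ let $C(S)$ be the set of elements commuting with every element of $S$, and $CC(a)=C(C(\{a\}))$. **Theorem (Borel functional calculus).** Let $(J_p)_{p\in P}$ be a spectral compression base on $A$ and let $a\in A$. Then $CC(a)$ is a linear subspace containing $a$, and there are a totally disconnected compact Hausdorff space $X$ and a unital linear order isomorphism $\Phi:CC(a)\to C(X,\mathbb R)$. The range of $\Phi(a)$ in $\mathbb R$ is the same for all such $X$ and $\Phi$; it is denoted by $sp(a)$. Let $\mathcal B(sp(a))$ be the algebra of bounded Borel functions $sp(a)\to\mathbb R$. There is a positive unital linear map $\Psi_a:\mathcal B(sp(a))\to CC(a)\subseteq A$ such that 1. $\Psi_a(\mathrm{id})=a$, where $\mathrm{id}$ is the function $t\mapsto t$; 2. $\Psi_a(\chi_B)\in P(a)$ for every Borel set $B\subseteq sp(a)$; 3.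 $\Psi_a(\max\{h_1,h_2\})$ is the supremum of $\Psi_a(h_1)$ and $\Psi_a(h_2)$ in $CC(a)$, for all $h_1,h_2\in\mathcal B(sp(a))$; 4. if $(h_n)$ is a nondecreasing sequence in $\mathcal B(sp(a))$ with pointwise supremum $h\in\mathcal B(sp(a))$, then $\Psi_a(h)$ is the supremum of $\{\Psi_a(h_n)\}_n$ in $CC(a)$. -/

import Mathlib

universe u

/-- An order unit space: an archimedean partially ordered real vector space `A` with order unit
`1`, equipped with its order unit norm.  (The order unit norm is determined by the order and the
unit, so the norm is no extra structure.) -/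
class OrderUnitSpace (A : Type*) [NormedAddCommGroup A] [NormedSpace ℝ A] [PartialOrder A]
    [IsOrderedAddMonoid A] [IsOrderedModule ℝ A] [One A] : Prop where
  zero_le_one' : (0 : A) ≤ 1
  exists_le_smul_one : ∀ a : A, ∃ r : ℝ, a ≤ r • (1 : A)
  archimedean : ∀ a b : A, (∀ n : ℕ, n • a ≤ b) → a ≤ 0
  norm_eq : ∀ a : A, ‖a‖ = sInf {r : ℝ | 0 ≤ r ∧ -(r • (1 : A)) ≤ a ∧ a ≤ r • (1 : A)}

/-- The unit interval `E = {e : 0 ≤ e ≤ 1}` (the effects). -/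
def effects (A : Type*) [Zero A] [One A] [LE A] : Set A := {e : A | 0 ≤ e ∧ e ≤ 1}

/-- Mackey compatibility in the effect algebra `E`. -/
def MackeyCompatible {A : Type*} [AddCommGroup A] [PartialOrder A] [One A] (a b : A) : Prop :=
  ∃ c ∈ effects A, ∃ a₁ ∈ effects A, ∃ b₁ ∈ effects A,
    c + a₁ + b₁ ∈ effects A ∧ a = c + a₁ ∧ b = c + b₁

/-- `J` is a compression with focus `p`. -/
structure IsCompression {A : Type*} [AddCommGroup A] [Module ℝ A] [PartialOrder A] [One A]
    (J : A →ₗ[ℝ] A) (p : A) : Prop where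
  positive : ∀ a : A, 0 ≤ a → 0 ≤ J a
  focus_mem : p ∈ effects A
  map_one : J 1 = p
  map_of_le : ∀ e ∈ effects A, e ≤ p → J e = e
  le_of_map_eq_zero : ∀ e ∈ effects A, J e = 0 → e ≤ 1 - p

/-- `P` is a normal subalgebra of the effect algebra `E`. -/
structure IsNormalSubalgebra {A : Type*} [AddCommGroup A] [PartialOrder A] [One A]
    (P : Set A) : Prop where
  subset_effects : P ⊆ effects A
  zero_mem : (0 : A) ∈ P
  one_mem : (1 : A) ∈ P
  compl_mem : ∀ p ∈ P, 1 - p ∈ P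
  add_mem : ∀ p ∈ P, ∀ q ∈ P, p + q ≤ 1 → p + q ∈ P
  normal : ∀ d ∈ effects A, ∀ e ∈ effects A, ∀ f ∈ effects A,
    d + e + f ≤ 1 → d + e ∈ P → d + f ∈ P → d ∈ P

/-- A compression base: a family `(J p)` of compressions indexed by their foci `p ∈ proj`.
(`J` is written as a total function; its values at `p ∉ proj` are never used.) -/
structure CompressionBase (A : Type*) [AddCommGroup A] [Module ℝ A] [PartialOrder A] [One A] where
  proj : Set A
  J : A → A →ₗ[ℝ] A
  normalSubalgebra : IsNormalSubalgebra proj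
  isCompression : ∀ p ∈ proj, IsCompression (J p) p
  comp_eq : ∀ p ∈ proj, ∀ q ∈ proj, ∀ r ∈ proj, p + q + r ≤ 1 →
    J (p + r) ∘ₗ J (q + r) = J r

namespace CompressionBase

section Algebraic

variable {A : Type*} [AddCommGroup A] [Module ℝ A] [PartialOrder A] [One A]

/-- `C(p)`: the elements of `A` commuting with the projection `p`. -/
def projCommutant (b : CompressionBase A) (p : A) : Set A :=
  {a : A | a = b.J p a + b.J (1 - p) a}

/-- `PC(S)`: the projections commuting with all elements of `S`. -/
def PC (b : CompressionBase A) (S : Set A) : Set A :=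
  {p : A | p ∈ b.proj ∧ ∀ a ∈ S, a ∈ b.projCommutant p}

/-- The P-bicommutant `P(a) = PC(PC(a) ∪ {a})`. -/
def projBicommutant (b : CompressionBase A) (a : A) : Set A :=
  b.PC (b.PC {a} ∪ {a})

/-- The projection cover property. -/
def HasProjectionCover (b : CompressionBase A) : Prop :=
  ∀ e ∈ effects A, ∃ p ∈ b.proj, ∀ q ∈ b.proj, e ≤ q ↔ p ≤ q

/-- The comparability property. -/
def HasComparability (b : CompressionBase A) : Prop :=
  ∀ a : A, ∃ p ∈ b.projBicommutant a, b.J (1 - p) a ≤ 0 ∧ 0 ≤ b.J p a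

/-- Spectral compression bases. -/
def IsSpectral (b : CompressionBase A) : Prop :=
  b.HasProjectionCover ∧ b.HasComparability

/-- `a C b'`: every projection in `P(a)` is compatible with every projection in `P(b')`. -/
def Commutes (b : CompressionBase A) (a b' : A) : Prop :=
  ∀ p ∈ b.projBicommutant a, ∀ q ∈ b.projBicommutant b', MackeyCompatible p q

/-- The commutant `C(S)` of a subset `S` of `A`. -/
def commutant (b : CompressionBase A) (S : Set A) : Set A :=
  {b' : A | ∀ a ∈ S, b.Commutes a b'}

/-- The bicommutant `CC(a) = C(C(a))`. -/
def bicommutant (b : CompressionBase A) (a : A) : Set A :=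
  b.commutant (b.commutant {a})

/-- `ι` is (the inverse of) an isomorphism `Φ : CC(a) ≅ C(X, ℝ)` of order unit spaces: it is
linear, unital, an order embedding (in particular injective), and its image is `CC(a)`. -/
structure IsFunctionRep (b : CompressionBase A) (a : A) {X : Type*} [TopologicalSpace X]
    (ι : C(X, ℝ) →ₗ[ℝ] A) : Prop where
  map_one : ι 1 = 1
  le_iff_le : ∀ f g : C(X, ℝ), ι f ≤ ι g ↔ f ≤ g
  range_eq : Set.range ι = b.bicommutant a

end Algebraic

/-- The spectrum of `a`: the range in `ℝ` of the function `f` that corresponds to `a` under an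
isomorphism `CC(a) ≅ C(X, ℝ)`, for `X` a totally disconnected compact Hausdorff space. -/
def spectrum {A : Type u} [AddCommGroup A] [Module ℝ A] [PartialOrder A] [One A]
    (b : CompressionBase A) (a : A) : Set ℝ :=
  {t : ℝ | ∃ (X : Type u) (_ : TopologicalSpace X) (_ : CompactSpace X) (_ : T2Space X)
    (_ : TotallyDisconnectedSpace X) (ι : C(X, ℝ) →ₗ[ℝ] A) (f : C(X, ℝ)),
    b.IsFunctionRep a ι ∧ ι f = a ∧ t ∈ Set.range f}

end CompressionBase

/-- The bounded Borel functions `S → ℝ`. -/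
def boundedBorel (S : Set ℝ) : Subalgebra ℝ (S → ℝ) where
  carrier := {h : S → ℝ | Measurable h ∧ ∃ M : ℝ, ∀ t, |h t| ≤ M}
  mul_mem' := by
    rintro g h ⟨hg, M, hM⟩ ⟨hh, N, hN⟩
    refine ⟨hg.mul hh, M * N, fun t => ?_⟩
    rw [Pi.mul_apply, abs_mul]
    exact mul_le_mul (hM t) (hN t) (abs_nonneg _) ((abs_nonneg _).trans (hM t))
  add_mem' := by
    rintro g h ⟨hg, M, hM⟩ ⟨hh, N, hN⟩
    exact ⟨hg.add hh, M + N, fun t => (abs_add_le _ _).trans (add_le_add (hM t) (hN t))⟩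
  algebraMap_mem' := fun r => ⟨measurable_const, |r|, fun _ => le_rfl⟩

/-- The characteristic function of a Borel set `B ⊆ S`. -/
noncomputable def boundedBorel.char {S : Set ℝ} (B : Set S) (hB : MeasurableSet B) :
    boundedBorel S :=
  ⟨B.indicator (fun _ => (1 : ℝ)), measurable_const.indicator hB, 1, fun t => by
    by_cases ht : t ∈ B <;> simp [ht]⟩

/-- The pointwise maximum of two bounded Borel functions. -/
noncomputable def boundedBorel.max {S : Set ℝ} (g h : boundedBorel S) : boundedBorel S :=
  ⟨fun t => Max.max (g.1 t) (h.1 t), g.2.1.max h.2.1, by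
    obtain ⟨M, hM⟩ := g.2.2
    obtain ⟨N, hN⟩ := h.2.2
    exact ⟨Max.max M N, fun t => abs_max_le_max_abs_abs.trans (max_le_max (hM t) (hN t))⟩⟩

/-! By comparability, every element `x` can be cut at any level `t` by a projection in `P(x)`, so
bisection makes `x` a norm limit of combinations of projections in `P(x)` (`exists_approx_span`).
Commuting with `x` therefore reduces to commuting with projections, and `CC(a)` becomes an
intersection of closed subspaces `C(p)`. Its elements commute with each other, and it is stable
under the compressions of its own projections.

The space `X` consists of the states of `CC(a)` with values 0 and 1 on projections. Every nonzero
projection supports one: an extreme point among the states equal to 1 there (`exists_character`).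
Together with spectral cuts, this makes evaluation an order embedding (`gelfandMap_nonneg_iff`).
Products of projections become meets, so Stone–Weierstrass and completeness give surjectivity
(`gelfandMap_surjective`). The range of the function `f` of `a` has a description inside the ordered
space `CC(a)` (`mem_range_iff`), so it does not depend on the representation.

The Borel calculus follows a Loomis–Sikorski argument. Projection covers give countable suprema in
`P(a)` (`exists_projBicommutant_sup`), and in `X` such a supremum differs from the union of clopen
sets by a meagre set (`exists_iUnion`). Hence the Borel sets whose preimage under `f` is, modulo
meagre sets, a clopen set from `P(a)` form a σ-algebra containing the rays (`exists_preimage`).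
Every `h ∘ f` with `h` bounded Borel then agrees off a meagre set with a continuous function, unique
by Baire's theorem; `Ψ h` is the corresponding element of `CC(a)`. The listed properties hold
pointwise off meagre sets, hence everywhere. -/

set_option linter.unusedSectionVars false

/-! ### Order unit norm and effects -/

namespace OrderUnitSpace

variable {A : Type*} [NormedAddCommGroup A] [NormedSpace ℝ A] [PartialOrder A]
    [IsOrderedAddMonoid A] [IsOrderedModule ℝ A] [One A] [OrderUnitSpace A]

theorem le_of_forall_pos_le_add_smul_one {x y : A} (h : ∀ ε : ℝ, 0 < ε → x ≤ y + ε • (1 : A)) :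
    x ≤ y := by
  rw [← sub_nonpos]
  refine archimedean (x - y) 1 fun n => ?_
  rcases Nat.eq_zero_or_pos n with rfl | hn
  · simpa using zero_le_one' (A := A)
  have hn' : (0 : ℝ) < n := by exact_mod_cast hn
  have h1 := h (n : ℝ)⁻¹ (inv_pos.2 hn')
  rw [← sub_le_iff_le_add'] at h1
  have h2 := smul_le_smul_of_nonneg_left h1 hn'.le
  rwa [smul_smul, mul_inv_cancel₀ hn'.ne', one_smul, Nat.cast_smul_eq_nsmul] at h2

theorem smul_one_mono {r s : ℝ} (h : r ≤ s) : r • (1 : A) ≤ s • (1 : A) :=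
  smul_le_smul_of_nonneg_right h zero_le_one'

theorem exists_bound (x : A) : ∃ r : ℝ, 0 ≤ r ∧ -(r • (1 : A)) ≤ x ∧ x ≤ r • (1 : A) := by
  obtain ⟨r, hr⟩ := exists_le_smul_one x
  obtain ⟨s, hs⟩ := exists_le_smul_one (-x)
  refine ⟨max 0 (max r s), le_max_left _ _, ?_, ?_⟩
  · rw [neg_le]
    exact hs.trans (smul_one_mono ((le_max_right _ _).trans (le_max_right _ _)))
  · exact hr.trans (smul_one_mono ((le_max_left _ _).trans (le_max_right _ _)))

theorem bddBelow_bounds (x : A) :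
    BddBelow {r : ℝ | 0 ≤ r ∧ -(r • (1 : A)) ≤ x ∧ x ≤ r • (1 : A)} :=
  ⟨0, fun _ h => h.1⟩

theorem le_norm_smul_one (x : A) : x ≤ ‖x‖ • (1 : A) := by
  refine le_of_forall_pos_le_add_smul_one fun ε hε => ?_
  obtain ⟨r, hr, hrε⟩ := exists_lt_of_csInf_lt (exists_bound x)
    (show sInf {r : ℝ | 0 ≤ r ∧ -(r • (1 : A)) ≤ x ∧ x ≤ r • (1 : A)} < ‖x‖ + ε by
      rw [← norm_eq]; linarith)
  rw [← add_smul]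
  exact hr.2.2.trans (smul_one_mono hrε.le)

theorem neg_norm_smul_one_le (x : A) : -(‖x‖ • (1 : A)) ≤ x := by
  have := le_norm_smul_one (-x)
  rwa [norm_neg, neg_le] at this

theorem norm_le_of_bounds {x : A} {r : ℝ} (hr : 0 ≤ r) (h₁ : -(r • (1 : A)) ≤ x)
    (h₂ : x ≤ r • (1 : A)) : ‖x‖ ≤ r := by
  rw [norm_eq]
  exact csInf_le (bddBelow_bounds x) ⟨hr, h₁, h₂⟩

theorem exists_smul_effect {x : A} (hx : 0 ≤ x) :
    ∃ r : ℝ, 0 < r ∧ ∃ e ∈ effects A, x = r • e := by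
  obtain ⟨r, hr, -, h⟩ := exists_bound x
  have hr' : 0 < r + 1 := by linarith
  refine ⟨r + 1, hr', (r + 1)⁻¹ • x, ⟨smul_nonneg (inv_nonneg.2 hr'.le) hx, ?_⟩, ?_⟩
  · have := smul_le_smul_of_nonneg_left (h.trans (smul_one_mono (by linarith : r ≤ r + 1)))
      (inv_nonneg.2 hr'.le)
    rwa [smul_smul, inv_mul_cancel₀ hr'.ne', one_smul] at this
  · rw [smul_smul, mul_inv_cancel₀ hr'.ne', one_smul]

theorem one_mem_effects : (1 : A) ∈ effects A := ⟨zero_le_one', le_rfl⟩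

theorem linearMap_ext_effects {B : Type*} [AddCommGroup B] [Module ℝ B] {f g : A →ₗ[ℝ] B}
    (h : ∀ e ∈ effects A, f e = g e) : f = g := by
  have hpos : ∀ x : A, 0 ≤ x → f x = g x := by
    intro x hx
    obtain ⟨r, -, e, he, rfl⟩ := exists_smul_effect hx
    simp [h e he]
  ext x
  have h1 := hpos (x + ‖x‖ • (1 : A)) (by
    have := neg_norm_smul_one_le x
    rwa [neg_le_iff_add_nonneg] at this)
  simpa [h 1 one_mem_effects] using h1

theorem isClosed_nonneg : IsClosed {x : A | 0 ≤ x} := by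
  refine isClosed_of_closure_subset fun x hx => ?_
  refine le_of_forall_pos_le_add_smul_one fun ε hε => ?_
  obtain ⟨y, hy, hxy⟩ := Metric.mem_closure_iff.1 hx ε hε
  rw [dist_eq_norm] at hxy
  have h1 := (neg_norm_smul_one_le (x - y)).trans' (neg_le_neg (smul_one_mono hxy.le))
  have h2 := add_le_add h1 (show (0 : A) ≤ y from hy)
  rw [add_zero, sub_add_cancel] at h2
  rwa [neg_le_iff_add_nonneg] at h2

theorem norm_effect_le {e : A} (he : e ∈ effects A) : ‖e‖ ≤ 1 :=
  norm_le_of_bounds zero_le_one (by simpa using he.1.trans' (neg_nonpos.2 zero_le_one'))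
    (by simpa using he.2)

end OrderUnitSpace

/-! ### Compressions, compatibility and the commutants `C(p)` -/

namespace CompressionBase

open OrderUnitSpace

variable {A : Type*} [NormedAddCommGroup A] [NormedSpace ℝ A] [PartialOrder A]
    [IsOrderedAddMonoid A] [IsOrderedModule ℝ A] [One A] [OrderUnitSpace A]
    {b : CompressionBase A} {p q r x y : A}

theorem effect_of_mem (hp : p ∈ b.proj) : p ∈ effects A := b.normalSubalgebra.subset_effects hp

theorem compl_mem (hp : p ∈ b.proj) : 1 - p ∈ b.proj := b.normalSubalgebra.compl_mem p hp

theorem J_mono (hp : p ∈ b.proj) (h : x ≤ y) : b.J p x ≤ b.J p y := by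
  have := (b.isCompression p hp).positive (y - x) (sub_nonneg.2 h)
  rwa [map_sub, sub_nonneg] at this

theorem J_nonneg (hp : p ∈ b.proj) (h : 0 ≤ x) : 0 ≤ b.J p x :=
  (b.isCompression p hp).positive x h

theorem J_one (hp : p ∈ b.proj) : b.J p 1 = p := (b.isCompression p hp).map_one

theorem J_le (hp : p ∈ b.proj) (h : x ≤ 1) : b.J p x ≤ p :=
  (J_mono hp h).trans_eq (J_one hp)

theorem J_mem_effects (hp : p ∈ b.proj) (h : x ∈ effects A) : b.J p x ∈ effects A :=
  ⟨J_nonneg hp h.1, (J_le hp h.2).trans (effect_of_mem hp).2⟩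

theorem J_of_le (hp : p ∈ b.proj) (hx : 0 ≤ x) (h : x ≤ p) : b.J p x = x :=
  (b.isCompression p hp).map_of_le x ⟨hx, h.trans (effect_of_mem hp).2⟩ h

theorem J_self (hp : p ∈ b.proj) : b.J p p = p := J_of_le hp (effect_of_mem hp).1 le_rfl

theorem J_of_le_compl (hp : p ∈ b.proj) (hx : 0 ≤ x) (h : x ≤ 1 - p) : b.J p x = 0 := by
  refine le_antisymm ((J_mono hp h).trans_eq ?_) (J_nonneg hp hx)
  rw [map_sub, J_one hp, J_self hp, sub_self]

theorem J_compl_of_le (hp : p ∈ b.proj) (hx : 0 ≤ x) (h : x ≤ p) : b.J (1 - p) x = 0 :=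
  J_of_le_compl (compl_mem hp) hx (by simpa using h)

theorem le_of_J_compl_eq_zero (hp : p ∈ b.proj) (hx : x ∈ effects A) (h : b.J (1 - p) x = 0) :
    x ≤ p := by
  simpa using (b.isCompression _ (compl_mem hp)).le_of_map_eq_zero x hx h

theorem sub_mem (hp : p ∈ b.proj) (hq : q ∈ b.proj) (h : p ≤ q) : q - p ∈ b.proj := by
  have := compl_mem (b.normalSubalgebra.add_mem p hp (1 - q) (compl_mem hq) (by
    rw [add_sub_left_comm]
    exact add_le_of_nonpos_right (sub_nonpos.2 h)))
  rwa [add_sub_left_comm, sub_add_cancel_left, neg_sub] at this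

theorem J_comp_of_le (hp : p ∈ b.proj) (hq : q ∈ b.proj) (h : p ≤ q) (x : A) :
    b.J p (b.J q x) = b.J p x := by
  have := b.comp_eq 0 b.normalSubalgebra.zero_mem (q - p) (sub_mem hp hq h) p hp
    (by simpa using (effect_of_mem hq).2)
  simpa using LinearMap.congr_fun this x

theorem J_comp_of_ge (hp : p ∈ b.proj) (hq : q ∈ b.proj) (h : p ≤ q) (x : A) :
    b.J q (b.J p x) = b.J p x := by
  have := b.comp_eq (q - p) (sub_mem hp hq h) 0 b.normalSubalgebra.zero_mem p hp
    (by simpa using (effect_of_mem hq).2)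
  simpa using LinearMap.congr_fun this x

theorem J_comp_of_orthogonal (hp : p ∈ b.proj) (hq : q ∈ b.proj) (h : q ≤ 1 - p) (x : A) :
    b.J p (b.J q x) = 0 := by
  have : b.J p ∘ₗ b.J q = 0 := linearMap_ext_effects fun e he =>
    J_of_le_compl hp (J_nonneg hq he.1) ((J_le hq he.2).trans h)
  exact LinearMap.congr_fun this x

/-- `C(p)` as a linear subspace. -/
def projCommutantSubmodule (b : CompressionBase A) (p : A) : Submodule ℝ A :=
  LinearMap.eqLocus LinearMap.id (b.J p + b.J (1 - p))

theorem mem_projCommutantSubmodule : x ∈ b.projCommutantSubmodule p ↔ x ∈ b.projCommutant p :=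
  Iff.rfl

theorem one_mem_projCommutant (hp : p ∈ b.proj) : 1 ∈ b.projCommutant p := by
  simp [projCommutant, J_one hp, J_one (compl_mem hp)]

theorem sub_mem_projCommutant (hx : x ∈ b.projCommutant p) (hy : y ∈ b.projCommutant p) :
    x - y ∈ b.projCommutant p :=
  (b.projCommutantSubmodule p).sub_mem hx hy

theorem projCommutant_compl (b : CompressionBase A) (p : A) :
    b.projCommutant (1 - p) = b.projCommutant p := by
  ext x
  simp [projCommutant, add_comm]

theorem mackeyCompatible_symm (h : MackeyCompatible p q) : MackeyCompatible q p := by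
  obtain ⟨c, hc, p₁, hp₁, q₁, hq₁, h, hp, hq⟩ := h
  exact ⟨c, hc, q₁, hq₁, p₁, hp₁, by rwa [add_right_comm], hq, hp⟩

/-- The splitting `q = J_p q + J_{1-p} q` is itself a Mackey decomposition with common part `J_p q`:
the three parts add up to `p + J_{1-p} q`, which is at most `p + (1 - p)`. -/
theorem mackeyCompatible_of_mem (hp : p ∈ b.proj) (hq : q ∈ b.proj)
    (h : q ∈ b.projCommutant p) : MackeyCompatible p q := by
  have hqE := effect_of_mem hq
  have hp' := compl_mem hp
  have hle : b.J p q ≤ p := J_le hp hqE.2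
  refine ⟨b.J p q, J_mem_effects hp hqE, p - b.J p q, ⟨sub_nonneg.2 hle, ?_⟩,
    b.J (1 - p) q, J_mem_effects hp' hqE, ⟨?_, ?_⟩, by abel, h⟩
  · exact (sub_le_self _ (J_nonneg hp hqE.1)).trans (effect_of_mem hp).2
  · rw [add_sub_cancel]
    exact add_nonneg (effect_of_mem hp).1 (J_nonneg hp' hqE.1)
  · rw [add_sub_cancel, ← le_sub_iff_add_le']
    exact J_le hp' hqE.2

/-- The common part of two compatible projections. -/
theorem mackey_meet (hp : p ∈ b.proj) (hq : q ∈ b.proj) (h : MackeyCompatible p q) :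
    b.J p q ∈ b.proj ∧ b.J p ∘ₗ b.J q = b.J (b.J p q) ∧ b.J q p = b.J p q := by
  obtain ⟨c, hc, p₁, hp₁, q₁, hq₁, hE, hpc, hqc⟩ := h
  -- Normality makes the common part a projection, as the composition axiom requires. That axiom is
  -- used in both orders, and evaluation at 1 then identifies `c`.
  have hcP : c ∈ b.proj := b.normalSubalgebra.normal c hc p₁ hp₁ q₁ hq₁ hE.2 (hpc ▸ hp) (hqc ▸ hq)
  have hp₁P : p₁ ∈ b.proj := by
    have := sub_mem hcP hp (by rw [hpc]; exact le_add_of_nonneg_right hp₁.1)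
    rwa [hpc, add_sub_cancel_left] at this
  have hq₁P : q₁ ∈ b.proj := by
    have := sub_mem hcP hq (by rw [hqc]; exact le_add_of_nonneg_right hq₁.1)
    rwa [hqc, add_sub_cancel_left] at this
  have h₁ := b.comp_eq p₁ hp₁P q₁ hq₁P c hcP (by
    have := hE.2; rwa [add_assoc, add_comm] at this)
  have h₂ := b.comp_eq q₁ hq₁P p₁ hp₁P c hcP (by
    have := hE.2; rwa [add_assoc, add_comm, add_comm p₁] at this)
  rw [add_comm p₁, add_comm q₁, ← hpc, ← hqc] at h₁
  rw [add_comm p₁, add_comm q₁, ← hpc, ← hqc] at h₂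
  have e₁ : b.J p q = c := by
    have := LinearMap.congr_fun h₁ 1
    rwa [LinearMap.comp_apply, J_one hq, J_one hcP] at this
  have e₂ : b.J q p = c := by
    have := LinearMap.congr_fun h₂ 1
    rwa [LinearMap.comp_apply, J_one hp, J_one hcP] at this
  rw [e₁, e₂]
  exact ⟨hcP, h₁, rfl⟩

theorem mem_of_mackeyCompatible (hp : p ∈ b.proj)
    (h : MackeyCompatible p q) : q ∈ b.projCommutant p := by
  obtain ⟨c, hc, p₁, hp₁, q₁, hq₁, hE, hpc, hqc⟩ := h
  have hcp : c ≤ p := by rw [hpc]; exact le_add_of_nonneg_right hp₁.1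
  have hqp : q₁ ≤ 1 - p := by rw [hpc, le_sub_iff_add_le']; exact hE.2
  change q = b.J p q + b.J (1 - p) q
  conv_rhs => rw [hqc, map_add, map_add, J_of_le hp hc.1 hcp, J_of_le_compl hp hq₁.1 hqp,
    J_of_le (compl_mem hp) hq₁.1 hqp, J_compl_of_le hp hc.1 hcp, add_zero, zero_add]
  exact hqc

theorem mem_projCommutant_comm (hp : p ∈ b.proj) (hq : q ∈ b.proj) :
    q ∈ b.projCommutant p ↔ p ∈ b.projCommutant q :=
  ⟨fun h => mem_of_mackeyCompatible hq (mackeyCompatible_symm (mackeyCompatible_of_mem hp hq h)),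
   fun h => mem_of_mackeyCompatible hp (mackeyCompatible_symm (mackeyCompatible_of_mem hq hp h))⟩

theorem meet_mem (hp : p ∈ b.proj) (hq : q ∈ b.proj) (h : q ∈ b.projCommutant p) :
    b.J p q ∈ b.proj := (mackey_meet hp hq (mackeyCompatible_of_mem hp hq h)).1

theorem J_comp_meet (hp : p ∈ b.proj) (hq : q ∈ b.proj) (h : q ∈ b.projCommutant p) (x : A) :
    b.J p (b.J q x) = b.J (b.J p q) x :=
  LinearMap.congr_fun (mackey_meet hp hq (mackeyCompatible_of_mem hp hq h)).2.1 x

theorem meet_comm (hp : p ∈ b.proj) (hq : q ∈ b.proj) (h : q ∈ b.projCommutant p) :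
    b.J q p = b.J p q :=
  (mackey_meet hp hq (mackeyCompatible_of_mem hp hq h)).2.2

theorem J_comm (hp : p ∈ b.proj) (hq : q ∈ b.proj) (h : q ∈ b.projCommutant p) (x : A) :
    b.J p (b.J q x) = b.J q (b.J p x) := by
  rw [J_comp_meet hp hq h, J_comp_meet hq hp ((mem_projCommutant_comm hp hq).1 h),
    meet_comm hp hq h]

theorem compl_mem_projCommutant (hp : p ∈ b.proj) (h : x ∈ b.projCommutant p) :
    1 - x ∈ b.projCommutant p := sub_mem_projCommutant (one_mem_projCommutant hp) h

theorem self_mem_projCommutant (hp : p ∈ b.proj) : p ∈ b.projCommutant p := by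
  simp [projCommutant, J_self hp, J_compl_of_le hp (effect_of_mem hp).1 le_rfl]

/-- With `c = J_p q` and `d = J_p (1 - q)`, the element splits as `J_c x + J_d x + J_{1-p} x`. Both
`d` and `1 - p` lie below `1 - c`, so the last two terms are killed by `J_c` and fixed by `J_{1-c}`.
-/
theorem mem_projCommutant_meet (hp : p ∈ b.proj) (hq : q ∈ b.proj) (h : q ∈ b.projCommutant p)
    (hxp : x ∈ b.projCommutant p) (hxq : x ∈ b.projCommutant q) :
    x ∈ b.projCommutant (b.J p q) := by
  have hq' := compl_mem hq
  have h' := compl_mem_projCommutant hp h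
  have hc := meet_mem hp hq h
  have hd := meet_mem hp hq' h'
  have hsum : b.J p x = b.J (b.J p q) x + b.J (b.J p (1 - q)) x := by
    rw [← J_comp_meet hp hq h, ← J_comp_meet hp hq' h', ← map_add, ← hxq]
  have hdc : b.J p (1 - q) ≤ 1 - b.J p q := by
    rw [map_sub, J_one hp]
    exact sub_le_sub_right (effect_of_mem hp).2 _
  have hpc : 1 - p ≤ 1 - b.J p q := sub_le_sub_left (J_le hp (effect_of_mem hq).2) _
  have hxp' : b.J p x + b.J (1 - p) x = x := hxp.symm
  change x = _
  conv_rhs => rw [← hxp']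
  rw [hsum]
  simp only [map_add]
  rw [J_comp_of_le hc hc le_rfl, J_comp_of_orthogonal hc hd hdc,
    J_comp_of_orthogonal hc (compl_mem hp) hpc, J_comp_of_orthogonal (compl_mem hc) hc (by simp),
    J_comp_of_ge hd (compl_mem hc) hdc, J_comp_of_ge (compl_mem hp) (compl_mem hc) hpc,
    add_zero, add_zero, zero_add, ← add_assoc, ← hsum]
  exact hxp

theorem J_mem_projCommutant (hp : p ∈ b.proj) (hr : r ∈ b.proj) (h : p ∈ b.projCommutant r)
    (hx : x ∈ b.projCommutant r) : b.J p x ∈ b.projCommutant r := by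
  change _ = _
  have h' : p ∈ b.projCommutant (1 - r) := by rwa [projCommutant_compl]
  rw [J_comm hr hp h, J_comm (compl_mem hr) hp h', ← map_add, ← hx]

/-- `C(p)` is closed under order unit norm limits. -/
theorem mem_projCommutant_of_approx (hp : p ∈ b.proj)
    (h : ∀ ε : ℝ, 0 < ε → ∃ s ∈ b.projCommutant p, -(ε • (1 : A)) ≤ x - s ∧ x - s ≤ ε • (1 : A)) :
    x ∈ b.projCommutant p := by
  have hp' := compl_mem hp
  have bound : ∀ ε : ℝ, 0 < ε → x ≤ b.J p x + b.J (1 - p) x + ε • (1 : A) ∧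
      b.J p x + b.J (1 - p) x ≤ x + ε • (1 : A) := by
    intro ε hε
    -- Half of `ε` pays for replacing `x` by `s`, half for replacing the compressed `x` by the
    -- compressed `s`.
    obtain ⟨s, hs, h₁, h₂⟩ := h (ε / 2) (by linarith)
    have hs' : b.J p s + b.J (1 - p) s = s := hs.symm
    have a₁ := add_le_add (J_mono hp h₁) (J_mono hp' h₁)
    have a₂ := add_le_add (J_mono hp h₂) (J_mono hp' h₂)
    simp only [map_neg, map_smul, map_sub, J_one hp, J_one hp'] at a₁ a₂
    have e : (ε / 2) • p + (ε / 2) • (1 - p) = (ε / 2) • (1 : A) := by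
      rw [← smul_add, add_sub_cancel]
    have e' : b.J p x - b.J p s + (b.J (1 - p) x - b.J (1 - p) s) =
        b.J p x + b.J (1 - p) x - s := by
      conv_rhs => rw [← hs']
      abel
    rw [e'] at a₁ a₂
    rw [e] at a₂
    rw [← neg_add, e] at a₁
    have e2 : ε • (1 : A) = (ε / 2) • (1 : A) + (ε / 2) • (1 : A) := by
      rw [← add_smul, add_halves]
    rw [e2]
    constructor
    · have := add_le_add h₂ (neg_le_neg a₁)
      rw [neg_neg] at this
      rw [← sub_nonneg] at this ⊢
      convert this using 1
      abel
    · have := add_le_add a₂ (neg_le_neg h₁)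
      rw [neg_neg] at this
      rw [← sub_nonneg] at this ⊢
      convert this using 1
      abel
  exact le_antisymm (le_of_forall_pos_le_add_smul_one fun ε hε => (bound ε hε).1)
    (le_of_forall_pos_le_add_smul_one fun ε hε => (bound ε hε).2)

theorem isClosed_projCommutant (hp : p ∈ b.proj) : IsClosed (b.projCommutant p) := by
  refine isClosed_of_closure_subset fun x hx => mem_projCommutant_of_approx hp fun ε hε => ?_
  obtain ⟨s, hs, hxs⟩ := Metric.mem_closure_iff.1 hx ε hε
  rw [dist_eq_norm] at hxs
  exact ⟨s, hs, (neg_norm_smul_one_le _).trans' (neg_le_neg (smul_one_mono hxs.le)),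
    (le_norm_smul_one _).trans (smul_one_mono hxs.le)⟩

/-! ### The P-bicommutant -/

theorem mem_projBicommutant : p ∈ b.projBicommutant x ↔
    p ∈ b.proj ∧ x ∈ b.projCommutant p ∧
      ∀ q ∈ b.proj, x ∈ b.projCommutant q → q ∈ b.projCommutant p := by
  simp only [projBicommutant, PC, Set.mem_ofPred_eq, Set.mem_union, Set.mem_singleton_iff,
    forall_eq]
  constructor
  · rintro ⟨hp, h⟩
    exact ⟨hp, h x (Or.inr rfl), fun q hq hxq => h q (Or.inl ⟨hq, hxq⟩)⟩
  · rintro ⟨hp, hx, h⟩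
    refine ⟨hp, ?_⟩
    rintro y (⟨hy, hxy⟩ | rfl)
    · exact h y hy hxy
    · exact hx

theorem mem_projCommutant_sub_smul_one (hp : p ∈ b.proj) (t : ℝ) :
    x - t • (1 : A) ∈ b.projCommutant p ↔ x ∈ b.projCommutant p := by
  simp only [← mem_projCommutantSubmodule]
  exact Submodule.sub_mem_iff_left _ (Submodule.smul_mem _ t (one_mem_projCommutant hp))

theorem projBicommutant_sub_smul_one (x : A) (t : ℝ) :
    b.projBicommutant (x - t • (1 : A)) = b.projBicommutant x := by
  ext p
  simp only [mem_projBicommutant]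
  refine and_congr_right fun hp => ?_
  rw [mem_projCommutant_sub_smul_one hp]
  refine and_congr_right fun _ => forall₂_congr fun q hq => ?_
  rw [mem_projCommutant_sub_smul_one hq]

theorem compl_mem_projBicommutant (hp : p ∈ b.projBicommutant x) :
    1 - p ∈ b.projBicommutant x := by
  simp only [mem_projBicommutant, projCommutant_compl] at hp ⊢
  exact ⟨compl_mem hp.1, hp.2⟩

theorem one_mem_projBicommutant : 1 ∈ b.projBicommutant x := by
  have hz := b.normalSubalgebra.zero_mem
  have h : ∀ y : A, y ∈ b.projCommutant 1 := by
    intro y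
    have : LinearMap.id = b.J 1 + b.J (1 - 1) := linearMap_ext_effects fun e he => by
      have h1 := J_of_le b.normalSubalgebra.one_mem he.1 he.2
      have h0 := J_compl_of_le b.normalSubalgebra.one_mem he.1 he.2
      simp [h1] at h0 ⊢
      exact h0
    exact LinearMap.congr_fun this y
  exact mem_projBicommutant.2 ⟨b.normalSubalgebra.one_mem, h x, fun q _ _ => h q⟩

theorem mem_projCommutant_of_mem_projBicommutant (hp : p ∈ b.projBicommutant x)
    (hq : q ∈ b.projBicommutant x) : q ∈ b.projCommutant p := by
  rw [mem_projBicommutant] at hp hq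
  exact hp.2.2 q hq.1 hq.2.1

theorem meet_mem_projBicommutant (hp : p ∈ b.projBicommutant x) (hq : q ∈ b.projBicommutant x) :
    b.J p q ∈ b.projBicommutant x := by
  have h := mem_projCommutant_of_mem_projBicommutant hp hq
  rw [mem_projBicommutant] at hp hq ⊢
  exact ⟨meet_mem hp.1 hq.1 h, mem_projCommutant_meet hp.1 hq.1 h hp.2.1 hq.2.1,
    fun r hr hxr => mem_projCommutant_meet hp.1 hq.1 h (hp.2.2 r hr hxr) (hq.2.2 r hr hxr)⟩

theorem self_mem_projBicommutant (hp : p ∈ b.proj) : p ∈ b.projBicommutant p :=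
  mem_projBicommutant.2 ⟨hp, self_mem_projCommutant hp,
    fun _ hq h => (mem_projCommutant_comm hp hq).2 h⟩

/-- Comparability applied to `x - t • 1`, which has the same P-bicommutant as `x`: a spectral cut at
level `t`. -/
theorem exists_projection_comparability (hb : b.HasComparability) (x : A) (t : ℝ) :
    ∃ p ∈ b.projBicommutant x, b.J (1 - p) x ≤ t • (1 - p) ∧ t • p ≤ b.J p x := by
  obtain ⟨p, hp, h₁, h₂⟩ := hb (x - t • (1 : A))
  rw [projBicommutant_sub_smul_one] at hp
  have hpP := (mem_projBicommutant.1 hp).1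
  refine ⟨p, hp, ?_, ?_⟩
  · simpa [J_one (compl_mem hpP)] using h₁
  · simpa [J_one hpP] using h₂

/-- Bisection: a cut at the midpoint of `[l, u]` splits `p` into two orthogonal projections on each
of which the interval has half the length. Their error bounds are multiples of the two pieces and
add up to a multiple of `p`. The induction needs arbitrary `p` because it descends to these pieces.
-/
theorem exists_approx_span_aux (hb : b.HasComparability) (x : A) (n : ℕ) :
    ∀ p ∈ b.projBicommutant x, ∀ l u : ℝ, l • p ≤ b.J p x → b.J p x ≤ u • p →
      ∃ s ∈ Submodule.span ℝ (b.projBicommutant x),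
        -(((u - l) / 2 ^ n) • p) ≤ b.J p x - s ∧ b.J p x - s ≤ ((u - l) / 2 ^ n) • p := by
  induction n with
  | zero =>
    intro p hp l u hl hu
    refine ⟨l • p, Submodule.smul_mem _ _ (Submodule.subset_span hp), ?_, ?_⟩
    · have h1 : 0 ≤ b.J p x - l • p := sub_nonneg.2 hl
      have h2 : 0 ≤ (u - l) • p := by
        rw [sub_smul]; exact sub_nonneg.2 (hl.trans hu)
      simpa using h1.trans' (neg_nonpos.2 h2)
    · simpa [sub_smul] using hu
  | succ n ih =>
    intro p hp l u hl hu
    obtain ⟨q, hq, hq₁, hq₂⟩ := exists_projection_comparability hb x ((l + u) / 2)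
    have hq' := compl_mem_projBicommutant hq
    have hc := meet_mem_projBicommutant hp hq
    have hd := meet_mem_projBicommutant hp hq'
    have hpq := mem_projCommutant_of_mem_projBicommutant hp hq
    have hpq' := mem_projCommutant_of_mem_projBicommutant hp hq'
    have hpP := (mem_projBicommutant.1 hp).1
    have hqP := (mem_projBicommutant.1 hq).1
    have hqP' := (mem_projBicommutant.1 hq').1
    have c₁ : ((l + u) / 2) • b.J p q ≤ b.J (b.J p q) x := by
      rw [← J_comp_meet hpP hqP hpq, ← map_smul]
      exact J_mono hpP hq₂
    have c₂ : b.J (b.J p q) x ≤ u • b.J p q := by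
      rw [← J_comp_meet hpP hqP hpq, J_comm hpP hqP hpq, ← meet_comm hpP hqP hpq, ← map_smul]
      exact J_mono hqP hu
    have d₁ : b.J (b.J p (1 - q)) x ≤ ((l + u) / 2) • b.J p (1 - q) := by
      rw [← J_comp_meet hpP hqP' hpq', ← map_smul]
      exact J_mono hpP hq₁
    have d₂ : l • b.J p (1 - q) ≤ b.J (b.J p (1 - q)) x := by
      rw [← J_comp_meet hpP hqP' hpq', J_comm hpP hqP' hpq', ← meet_comm hpP hqP' hpq',
        ← map_smul]
      exact J_mono hqP' hl
    obtain ⟨s, hs, s₁, s₂⟩ := ih _ hc _ _ c₁ c₂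
    obtain ⟨t, ht, t₁, t₂⟩ := ih _ hd _ _ d₂ d₁
    have e₁ : (u - (l + u) / 2) / 2 ^ n = (u - l) / 2 ^ (n + 1) := by
      rw [pow_succ]; field_simp; ring
    have e₂ : ((l + u) / 2 - l) / 2 ^ n = (u - l) / 2 ^ (n + 1) := by
      rw [pow_succ]; field_simp; ring
    rw [e₁] at s₁ s₂
    rw [e₂] at t₁ t₂
    have e₃ : b.J p x = b.J (b.J p q) x + b.J (b.J p (1 - q)) x := by
      rw [← J_comp_meet hpP hqP hpq, ← J_comp_meet hpP hqP' hpq', ← map_add]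
      exact congrArg _ (mem_projBicommutant.1 hq).2.1
    have e₄ : p = b.J p q + b.J p (1 - q) := by
      rw [← map_add, add_sub_cancel, J_one hpP]
    refine ⟨s + t, Submodule.add_mem _ hs ht, ?_, ?_⟩
    · rw [e₃, add_sub_add_comm]
      refine le_trans (le_of_eq ?_) (add_le_add s₁ t₁)
      conv_lhs => rw [e₄]
      rw [smul_add, neg_add]
    · rw [e₃, add_sub_add_comm]
      refine (add_le_add s₂ t₂).trans (le_of_eq ?_)
      conv_rhs => rw [e₄]
      rw [smul_add]

/-- Every `x` is a norm limit of linear combinations of projections in `P(x)`. -/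
theorem exists_approx_span (hb : b.HasComparability) (x : A) {ε : ℝ} (hε : 0 < ε) :
    ∃ s ∈ Submodule.span ℝ (b.projBicommutant x),
      -(ε • (1 : A)) ≤ x - s ∧ x - s ≤ ε • (1 : A) := by
  have h1 : b.J 1 x = x := by
    have : b.J 1 = LinearMap.id := linearMap_ext_effects fun e he =>
      J_of_le b.normalSubalgebra.one_mem he.1 he.2
    rw [this, LinearMap.id_apply]
  -- The initial interval has length `2 * ‖x‖`; the added 1 keeps the denominator positive when `x =
  -- 0`.
  obtain ⟨n, hn⟩ := exists_pow_lt_of_lt_one (show 0 < ε / (2 * ‖x‖ + 1) by positivity)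
    (by norm_num : (1 / 2 : ℝ) < 1)
  obtain ⟨s, hs, s₁, s₂⟩ := exists_approx_span_aux hb x n 1 one_mem_projBicommutant (-‖x‖) ‖x‖
    (by rw [h1, neg_smul]; exact neg_norm_smul_one_le x) (by rw [h1]; exact le_norm_smul_one x)
  rw [h1] at s₁ s₂
  have hle : (‖x‖ - -‖x‖) / 2 ^ n ≤ ε := by
    rw [lt_div_iff₀ (by positivity)] at hn
    have : (‖x‖ - -‖x‖) / 2 ^ n = (1 / 2 : ℝ) ^ n * (2 * ‖x‖) := by
      rw [one_div, inv_pow]; field_simp; ring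
    rw [this]
    refine le_trans ?_ hn.le
    gcongr
    linarith
  exact ⟨s, hs, s₁.trans' (neg_le_neg (smul_one_mono hle)), s₂.trans (smul_one_mono hle)⟩

/-- One direction is the definition of `P(x)` and symmetry of compatibility; the other holds because
`C(p)` is a closed subspace and `x` is a limit of combinations from `P(x)`. -/
theorem mem_projCommutant_iff (hb : b.HasComparability) (hp : p ∈ b.proj) :
    x ∈ b.projCommutant p ↔ ∀ q ∈ b.projBicommutant x, q ∈ b.projCommutant p := by
  constructor
  · intro hx q hq
    rw [mem_projBicommutant] at hq
    exact (mem_projCommutant_comm hq.1 hp).1 (hq.2.2 p hp hx)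
  · intro h
    refine mem_projCommutant_of_approx hp fun ε hε => ?_
    obtain ⟨s, hs, h'⟩ := exists_approx_span hb x hε
    exact ⟨s, (Submodule.span_le (p := b.projCommutantSubmodule p)).2 h hs, h'⟩

/-- This writes the set of elements commuting with `x` as an intersection of closed subspaces
`C(p)`, the source of the linear structure on `CC(a)`. -/
theorem commutes_iff (hb : b.HasComparability) :
    b.Commutes x y ↔ ∀ p ∈ b.projBicommutant x, y ∈ b.projCommutant p := by
  refine forall₂_congr fun p hp => ?_
  have hpP := (mem_projBicommutant.1 hp).1
  rw [mem_projCommutant_iff hb hpP]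
  refine forall₂_congr fun q hq => ?_
  exact ⟨mem_of_mackeyCompatible hpP,
    mackeyCompatible_of_mem hpP (mem_projBicommutant.1 hq).1⟩

theorem commutes_symm (h : b.Commutes x y) : b.Commutes y x :=
  fun p hp q hq => mackeyCompatible_symm (h q hq p hp)

theorem commutes_self (x : A) : b.Commutes x x := fun _ hp _ hq =>
  mackeyCompatible_of_mem (mem_projBicommutant.1 hp).1 (mem_projBicommutant.1 hq).1
    (mem_projCommutant_of_mem_projBicommutant hp hq)

/-! ### The bicommutant -/

variable {a : A}

theorem mem_bicommutant_iff (hb : b.HasComparability) : x ∈ b.bicommutant a ↔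
    ∀ y, b.Commutes a y → ∀ p ∈ b.projBicommutant y, x ∈ b.projCommutant p := by
  simp only [bicommutant, commutant, Set.mem_ofPred_eq, Set.mem_singleton_iff, forall_eq]
  exact forall₂_congr fun y _ => commutes_iff hb

/-- `CC(a)` as a linear subspace. -/
def bicommutantSubmodule (b : CompressionBase A) (a : A) : Submodule ℝ A :=
  ⨅ (y : A) (_ : b.Commutes a y) (p : A) (_ : p ∈ b.projBicommutant y),
    b.projCommutantSubmodule p

theorem mem_bicommutantSubmodule (hb : b.HasComparability) :
    x ∈ b.bicommutantSubmodule a ↔ x ∈ b.bicommutant a := by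
  rw [mem_bicommutant_iff hb]
  simp only [bicommutantSubmodule, Submodule.mem_iInf, mem_projCommutantSubmodule]

theorem isClosed_bicommutantSubmodule (b : CompressionBase A) (a : A) :
    IsClosed (b.bicommutantSubmodule a : Set A) := by
  simp only [bicommutantSubmodule, Submodule.coe_iInf]
  exact isClosed_iInter fun _ => isClosed_iInter fun _ => isClosed_iInter fun _ =>
    isClosed_iInter fun hp => isClosed_projCommutant (mem_projBicommutant.1 hp).1

theorem one_mem_bicommutant (hb : b.HasComparability) : 1 ∈ b.bicommutant a :=
  (mem_bicommutant_iff hb).2 fun _ _ _ hp => one_mem_projCommutant (mem_projBicommutant.1 hp).1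

theorem self_mem_bicommutant (a : A) : a ∈ b.bicommutant a :=
  fun _ hy => commutes_symm (hy a rfl)

theorem bicommutant_subset_commutant : b.bicommutant a ⊆ b.commutant {a} := by
  rintro x hx y rfl
  refine hx y fun z hz => ?_
  rw [Set.mem_singleton_iff.1 hz]
  exact commutes_self y

theorem commutes_of_mem_bicommutant (hx : x ∈ b.bicommutant a) (hy : y ∈ b.bicommutant a) :
    b.Commutes x y := hy x (bicommutant_subset_commutant hx)

theorem mem_projCommutant_of_mem_bicommutant (hb : b.HasComparability) (hp : p ∈ b.proj)
    (hpa : p ∈ b.bicommutant a) (hx : x ∈ b.bicommutant a) : x ∈ b.projCommutant p :=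
  (commutes_iff hb).1 (commutes_of_mem_bicommutant hpa hx) p (self_mem_projBicommutant hp)

theorem projBicommutant_subset_bicommutant (hb : b.HasComparability)
    (hx : x ∈ b.bicommutant a) : b.projBicommutant x ⊆ b.bicommutant a := by
  intro q hq
  rw [mem_bicommutant_iff hb] at hx ⊢
  intro y hy p hp
  exact (mem_projCommutant_iff hb (mem_projBicommutant.1 hp).1).1 (hx y hy p hp) q hq

theorem J_mem_bicommutant (hb : b.HasComparability) (hp : p ∈ b.proj)
    (hpa : p ∈ b.bicommutant a) (hx : x ∈ b.bicommutant a) : b.J p x ∈ b.bicommutant a := by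
  rw [mem_bicommutant_iff hb] at hpa hx ⊢
  intro y hy r hr
  exact J_mem_projCommutant hp (mem_projBicommutant.1 hr).1 (hpa y hy r hr) (hx y hy r hr)

/-! ### Countable suprema of projections -/

/-- The cover of `e` is the sum of the covers of `J_r e` and `J_{1-r} e`. These lie below `r` and `1
- r`, so their sum is split by `r`. -/
theorem projCover_mem_projCommutant (hb : b.HasProjectionCover) {e s : A} (he : e ∈ effects A)
    (hs : s ∈ b.proj) (hes : ∀ q ∈ b.proj, e ≤ q ↔ s ≤ q) (hr : r ∈ b.proj)
    (h : e ∈ b.projCommutant r) : s ∈ b.projCommutant r := by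
  have hr' := compl_mem hr
  obtain ⟨s₁, hs₁, h₁⟩ := hb _ (J_mem_effects hr he)
  obtain ⟨s₂, hs₂, h₂⟩ := hb _ (J_mem_effects hr' he)
  have le₁ : s₁ ≤ r := (h₁ r hr).1 (J_le hr he.2)
  have le₂ : s₂ ≤ 1 - r := (h₂ _ hr').1 (J_le hr' he.2)
  have hsum : s₁ + s₂ ∈ b.proj := b.normalSubalgebra.add_mem _ hs₁ _ hs₂
    ((add_le_add le₁ le₂).trans_eq (by abel))
  have he_s : e ≤ s := (hes s hs).2 le_rfl
  have h' : b.J r e + b.J (1 - r) e = e := h.symm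
  have le₃ : s ≤ s₁ + s₂ := (hes _ hsum).1 (by
    rw [← h']
    exact add_le_add ((h₁ _ hs₁).2 le_rfl) ((h₂ _ hs₂).2 le_rfl))
  have le₄ : s₁ ≤ s := (h₁ s hs).1 (he_s.trans' (by
    conv_rhs => rw [← h']
    exact le_add_of_nonneg_right (J_nonneg hr' he.1)))
  have le₅ : s₂ ≤ s := (h₂ s hs).1 (he_s.trans' (by
    conv_rhs => rw [← h']
    exact le_add_of_nonneg_left (J_nonneg hr he.1)))
  have le₆ : s₁ + s₂ ≤ s := by
    have := J_le hs (effect_of_mem hsum).2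
    rwa [map_add, J_of_le hs (effect_of_mem hs₁).1 le₄,
      J_of_le hs (effect_of_mem hs₂).1 le₅] at this
  rw [le_antisymm le₃ le₆]
  change _ = _
  rw [map_add, map_add, J_of_le hr (effect_of_mem hs₁).1 le₁,
    J_of_le_compl hr (effect_of_mem hs₂).1 le₂, J_of_le hr' (effect_of_mem hs₂).1 le₂,
    J_compl_of_le hr (effect_of_mem hs₁).1 le₁, add_zero, zero_add]

/-- The supremum is the projection cover of `∑ p n / 2 ^ (n + 1)`. The weights add up to 1, so this
effect is below any common upper bound of the `p n`; conversely, a projection above it dominates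
each `p n`, whose weight is positive. The last clause uses that `C(r)` is closed. -/
theorem exists_projection_sup [CompleteSpace A] (hb : b.HasProjectionCover) {p : ℕ → A}
    (hp : ∀ n, p n ∈ b.proj) :
    ∃ s ∈ b.proj, (∀ n, p n ≤ s) ∧ (∀ q ∈ b.proj, (∀ n, p n ≤ q) → s ≤ q) ∧
      ∀ r ∈ b.proj, (∀ n, p n ∈ b.projCommutant r) → s ∈ b.projCommutant r := by
  set w : ℕ → ℝ := fun n => 1 / 2 / 2 ^ n with hw
  have hw0 : ∀ n, 0 < w n := fun n => by simp only [hw]; positivity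
  have hwsum : HasSum w 1 := hasSum_geometric_two' 1
  have hsum : Summable fun n => w n • p n := by
    refine Summable.of_norm_bounded hwsum.summable fun n => ?_
    rw [norm_smul, Real.norm_of_nonneg (hw0 n).le]
    exact mul_le_of_le_one_right (hw0 n).le (norm_effect_le (effect_of_mem (hp n)))
  have : OrderClosedTopology A := by
    refine ⟨?_⟩
    have h := (isClosed_nonneg (A := A)).preimage
      (continuous_snd.sub continuous_fst : Continuous fun z : A × A => z.2 - z.1)
    convert h using 1
    ext z
    simp
  set e := ∑' n, w n • p n
  have he := hsum.hasSum
  have nonneg : ∀ n, 0 ≤ w n • p n := fun n =>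
    smul_nonneg (hw0 n).le (effect_of_mem (hp n)).1
  have key : ∀ q : A, (∀ n, p n ≤ q) → e ≤ q := by
    intro q hq
    have h2 : HasSum (fun n => w n • q) ((1 : ℝ) • q) := hwsum.smul_const q
    rw [one_smul] at h2
    exact hasSum_le (fun n => smul_le_smul_of_nonneg_left (hq n) (hw0 n).le) he h2
  have heE : e ∈ effects A := ⟨he.nonneg nonneg, key 1 fun n => (effect_of_mem (hp n)).2⟩
  obtain ⟨s, hs, hes⟩ := hb e heE
  refine ⟨s, hs, fun n => ?_, fun q hq h => (hes q hq).1 (key q h), fun r hr h => ?_⟩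
  · refine le_of_J_compl_eq_zero hs (effect_of_mem (hp n)) ?_
    have h0 : b.J (1 - s) e = 0 := J_compl_of_le hs heE.1 ((hes s hs).2 le_rfl)
    have hle : w n • p n ≤ e := le_hasSum he n fun m _ => nonneg m
    have h1 := J_mono (compl_mem hs) hle
    rw [h0] at h1
    have h2 := le_antisymm h1 (J_nonneg (compl_mem hs) (nonneg n))
    rw [map_smul] at h2
    exact (smul_eq_zero.1 h2).resolve_left (hw0 n).ne'
  · refine projCover_mem_projCommutant hb heE hs hes hr ?_
    exact (isClosed_projCommutant hr).mem_of_tendsto he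
      (Filter.Eventually.of_forall fun F => (b.projCommutantSubmodule r).sum_mem fun n _ =>
        (b.projCommutantSubmodule r).smul_mem _ (h n))

theorem exists_projBicommutant_sup [CompleteSpace A] (hb : b.IsSpectral) {p : ℕ → A}
    (hp : ∀ n, p n ∈ b.projBicommutant a) :
    ∃ s ∈ b.projBicommutant a, (∀ n, p n ≤ s) ∧ ∀ q ∈ b.proj, (∀ n, p n ≤ q) → s ≤ q := by
  obtain ⟨s, hs, h₁, h₂, h₃⟩ := exists_projection_sup hb.1 fun n => (mem_projBicommutant.1 (hp n)).1
  refine ⟨s, mem_projBicommutant.2 ⟨hs, ?_, ?_⟩, h₁, h₂⟩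
  · rw [mem_projCommutant_iff hb.2 hs]
    intro q hq
    exact (mem_projCommutant_comm hs (mem_projBicommutant.1 hq).1).2
      (h₃ q (mem_projBicommutant.1 hq).1 fun n => mem_projCommutant_of_mem_projBicommutant hq (hp n))
  · intro r hr har
    refine (mem_projCommutant_comm hs hr).2 (h₃ r hr fun n => ?_)
    have := mem_projBicommutant.1 (hp n)
    exact (mem_projCommutant_comm this.1 hr).1 (this.2.2 r hr har)

end CompressionBase

/-! ### States and characters of `CC(a)` -/

namespace CompressionBase

open OrderUnitSpace

variable {A : Type*} [NormedAddCommGroup A] [NormedSpace ℝ A] [PartialOrder A]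
    [IsOrderedAddMonoid A] [IsOrderedModule ℝ A] [One A] [OrderUnitSpace A]
    {b : CompressionBase A} {p q r x y a : A}

/-- The states of `CC(a)`. -/
def bicommutantStates (b : CompressionBase A) (a : A) : Set (b.bicommutantSubmodule a → ℝ) :=
  {φ | (∀ x y, φ (x + y) = φ x + φ y) ∧ (∀ (t : ℝ) x, φ (t • x) = t * φ x) ∧
    (∀ x : b.bicommutantSubmodule a, 0 ≤ (x : A) → 0 ≤ φ x) ∧
    ∀ x : b.bicommutantSubmodule a, (x : A) = 1 → φ x = 1}

/-- The states of `CC(a)` that take only the values `0` and `1` on projections. -/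
def bicommutantCharacters (b : CompressionBase A) (a : A) :
    Set (b.bicommutantSubmodule a → ℝ) :=
  {φ | φ ∈ b.bicommutantStates a ∧
    ∀ x : b.bicommutantSubmodule a, (x : A) ∈ b.proj → φ x = 0 ∨ φ x = 1}

namespace bicommutantStates

variable {φ : b.bicommutantSubmodule a → ℝ}

theorem map_add (hφ : φ ∈ b.bicommutantStates a) (x y) : φ (x + y) = φ x + φ y := hφ.1 x y

theorem map_smul (hφ : φ ∈ b.bicommutantStates a) (t : ℝ) (x) : φ (t • x) = t * φ x := hφ.2.1 t x

theorem map_sub (hφ : φ ∈ b.bicommutantStates a) (x y) : φ (x - y) = φ x - φ y := by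
  have := map_add hφ (x - y) y
  rw [sub_add_cancel] at this
  linarith

theorem mono (hφ : φ ∈ b.bicommutantStates a) {x y : b.bicommutantSubmodule a}
    (h : (x : A) ≤ y) : φ x ≤ φ y := by
  have := hφ.2.2.1 (y - x) (by simpa using h)
  rw [map_sub hφ] at this
  linarith

theorem abs_le_norm (hb : b.HasComparability) (hφ : φ ∈ b.bicommutantStates a)
    (x : b.bicommutantSubmodule a) : φ x ∈ Set.Icc (-‖x‖) ‖x‖ := by
  have h1M : (1 : A) ∈ b.bicommutantSubmodule a :=
    (mem_bicommutantSubmodule hb).2 (one_mem_bicommutant hb)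
  have h1 : φ ⟨1, h1M⟩ = 1 := hφ.2.2.2 _ rfl
  constructor
  · have := mono hφ (x := (-‖x‖) • ⟨1, h1M⟩) (y := x) (by
      simpa using neg_norm_smul_one_le (x : A))
    rwa [map_smul hφ, h1, mul_one] at this
  · have := mono hφ (x := x) (y := ‖x‖ • ⟨1, h1M⟩) (by
      simpa using le_norm_smul_one (x : A))
    rwa [map_smul hφ, h1, mul_one] at this

end bicommutantStates

open bicommutantStates

theorem isClosed_bicommutantStates (b : CompressionBase A) (a : A) :
    IsClosed (b.bicommutantStates a) := by
  have e : b.bicommutantStates a =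
      (⋂ (x : b.bicommutantSubmodule a) (y : b.bicommutantSubmodule a),
          {φ | φ (x + y) = φ x + φ y}) ∩
      ((⋂ (t : ℝ) (x : b.bicommutantSubmodule a), {φ | φ (t • x) = t * φ x}) ∩
      ((⋂ (x : b.bicommutantSubmodule a) (_ : 0 ≤ (x : A)), {φ | 0 ≤ φ x}) ∩
      (⋂ (x : b.bicommutantSubmodule a) (_ : (x : A) = 1), {φ | φ x = 1}))) := by
    ext φ
    simp only [bicommutantStates, Set.mem_inter_iff, Set.mem_iInter, Set.mem_ofPred_eq]
  rw [e]
  refine IsClosed.inter (isClosed_iInter fun x => isClosed_iInter fun y => ?_) (IsClosed.inter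
    (isClosed_iInter fun t => isClosed_iInter fun x => ?_) (IsClosed.inter
    (isClosed_iInter fun x => isClosed_iInter fun _ => ?_)
    (isClosed_iInter fun x => isClosed_iInter fun _ => ?_)))
  · exact isClosed_eq (by fun_prop) (by fun_prop)
  · exact isClosed_eq (continuous_apply _) (continuous_const.mul (continuous_apply _))
  · exact isClosed_le continuous_const (continuous_apply _)
  · exact isClosed_eq (continuous_apply _) continuous_const

theorem isCompact_bicommutantStates (hb : b.HasComparability) (a : A) :
    IsCompact (b.bicommutantStates a) :=
  (isCompact_univ_pi fun x : b.bicommutantSubmodule a =>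
    isCompact_Icc (a := -‖x‖) (b := ‖x‖)).of_isClosed_subset (isClosed_bicommutantStates b a)
    fun _ hφ x _ => abs_le_norm hb hφ x

theorem isCompact_bicommutantCharacters (hb : b.HasComparability) (a : A) :
    IsCompact (b.bicommutantCharacters a) := by
  refine (isCompact_bicommutantStates hb a).of_isClosed_subset ?_ fun _ h => h.1
  have e : b.bicommutantCharacters a = b.bicommutantStates a ∩
      ⋂ (x : b.bicommutantSubmodule a) (_ : (x : A) ∈ b.proj), {φ | φ x = 0} ∪ {φ | φ x = 1} := by
    ext φ
    simp only [bicommutantCharacters, Set.mem_inter_iff, Set.mem_iInter, Set.mem_ofPred_eq,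
      Set.mem_union]
  rw [e]
  exact (isClosed_bicommutantStates b a).inter (isClosed_iInter fun x => isClosed_iInter fun _ =>
    (isClosed_eq (continuous_apply _) continuous_const).union
      (isClosed_eq (continuous_apply _) continuous_const))

/-- A state supported by a projection `q` exists whenever `q ≠ 0`. -/
theorem exists_state (hq : q ∈ b.proj)
    (hqa : q ∈ b.bicommutantSubmodule a) (h0 : q ≠ 0) :
    ∃ φ ∈ b.bicommutantStates a, φ ⟨q, hqa⟩ = 1 := by
  obtain ⟨g, hg, hgq⟩ := exists_dual_vector ℝ q (norm_ne_zero_iff.2 h0)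
  have hqE := effect_of_mem hq
  -- Since `2e - 1` lies in the unit ball, the norming functional satisfies `2 g e - g 1 ≤ 1` on
  -- effects. The cases `e = q` and `e = 1` force `g 1 = 1`, and applying the bound to `1 - e` gives
  -- positivity.
  have hnorm : ∀ e ∈ effects A, ‖(2 : ℝ) • e - 1‖ ≤ 1 := by
    intro e he
    refine norm_le_of_bounds zero_le_one ?_ ?_
    · rw [one_smul, neg_le_sub_iff_le_add]
      exact le_add_of_nonneg_left (smul_nonneg zero_le_two he.1)
    · have := smul_le_smul_of_nonneg_left he.2 (zero_le_two (α := ℝ))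
      rw [one_smul, sub_le_iff_le_add, ← two_smul ℝ (1 : A)]
      exact this
  have hgle : ∀ e ∈ effects A, 2 * g e - g 1 ≤ 1 := by
    intro e he
    have h1 : g ((2 : ℝ) • e - 1) ≤ 1 := by
      refine (le_abs_self _).trans ((g.le_opNorm ((2 : ℝ) • e - 1)).trans ?_)
      rw [hg, one_mul]
      exact hnorm e he
    rw [_root_.map_sub, _root_.map_smul, smul_eq_mul] at h1
    exact h1
  have hq1 : ‖q‖ = 1 := by
    have h1 : 1 ≤ ‖q‖ := by
      by_contra! hlt
      -- Compressing `q ≤ ‖q‖ • 1` by `J_q`; with `‖q‖ < 1` this would force `q = 0`.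
      have h2 : q ≤ ‖q‖ • q := by
        have := J_mono hq (le_norm_smul_one q)
        rwa [_root_.map_smul, J_one hq, J_self hq] at this
      have h3 : (1 - ‖q‖) • q ≤ 0 := by
        rw [sub_smul, one_smul]; exact sub_nonpos.2 h2
      have h4 := smul_le_smul_of_nonneg_left h3 (inv_nonneg.2 (sub_nonneg.2 hlt.le))
      rw [smul_smul, inv_mul_cancel₀ (sub_pos.2 hlt).ne', one_smul, smul_zero] at h4
      exact h0 (le_antisymm h4 hqE.1)
    exact le_antisymm (norm_effect_le hqE) h1
  have hgq1 : g q = 1 := by rw [hgq, hq1]; rfl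
  have hg1 : g 1 = 1 := by
    have h1 := hgle q hqE
    have h2 := hgle 1 one_mem_effects
    rw [hgq1] at h1
    linarith
  have hpos : ∀ x : A, 0 ≤ x → 0 ≤ g x := by
    intro x hx
    obtain ⟨t, ht, e, he, rfl⟩ := exists_smul_effect hx
    have h1 := hgle (1 - e) ⟨sub_nonneg.2 he.2, sub_le_self _ he.1⟩
    rw [_root_.map_sub, hg1] at h1
    rw [_root_.map_smul, smul_eq_mul]
    exact mul_nonneg ht.le (by linarith)
  refine ⟨fun x => g x, ⟨fun x y => by simp, fun t x => by simp, fun x hx => hpos _ hx,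
    fun x hx => ?_⟩, hgq1⟩
  change g (x : A) = 1
  rw [hx, hg1]

/-- Conditioning a state on `p`. The conditional states at `p` and `1 - p` are the two convex
components used to test extremality. -/
theorem state_conditional (hb : b.HasComparability) {φ : b.bicommutantSubmodule a → ℝ}
    (hφ : φ ∈ b.bicommutantStates a) (hp : p ∈ b.proj) (hpa : p ∈ b.bicommutantSubmodule a)
    (h0 : φ ⟨p, hpa⟩ ≠ 0) :
    (fun x : b.bicommutantSubmodule a => (φ ⟨p, hpa⟩)⁻¹ * φ ⟨b.J p x, (mem_bicommutantSubmodule hb).2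
      (J_mem_bicommutant hb hp ((mem_bicommutantSubmodule hb).1 hpa)
        ((mem_bicommutantSubmodule hb).1 x.2))⟩) ∈ b.bicommutantStates a := by
  refine ⟨fun x y => ?_, fun t x => ?_, fun x hx => ?_, fun x hx => ?_⟩
  · rw [← mul_add, ← map_add hφ]
    exact congrArg (fun z => _ * φ z) (Subtype.ext (_root_.map_add (b.J p) (x : A) y))
  · rw [mul_left_comm, ← map_smul hφ]
    exact congrArg (fun z => _ * φ z) (Subtype.ext (_root_.map_smul (b.J p) t (x : A)))
  · exact mul_nonneg (inv_nonneg.2 (hφ.2.2.1 _ (effect_of_mem hp).1))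
      (hφ.2.2.1 _ (J_nonneg hp hx))
  · have : b.J p x = p := by rw [hx, J_one hp]
    simp only [this]
    exact inv_mul_cancel₀ h0

/-- Take an extreme point `φ` of the compact set of states equal to 1 at `q`. If `0 < φ p < 1`, then
`φ` is a proper convex combination of its conditional states at `p` and `1 - p`. Both have value at
most 1 at `q`, hence exactly 1, so extremality makes `φ` equal to the first one, whose value at `p`
is 1. -/
theorem exists_character (hb : b.HasComparability) (hq : q ∈ b.proj)
    (hqa : q ∈ b.bicommutantSubmodule a) (h0 : q ≠ 0) :
    ∃ φ ∈ b.bicommutantCharacters a, φ ⟨q, hqa⟩ = 1 := by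
  set S : Set (b.bicommutantSubmodule a → ℝ) := b.bicommutantStates a ∩ {φ | φ ⟨q, hqa⟩ = 1}
  have hS : IsCompact S := (isCompact_bicommutantStates hb a).inter_right
    (isClosed_eq (continuous_apply _) continuous_const)
  obtain ⟨φ, hφ⟩ := hS.extremePoints_nonempty (by
    obtain ⟨φ, h₁, h₂⟩ := exists_state hq hqa h0
    exact ⟨φ, h₁, h₂⟩)
  rw [mem_extremePoints] at hφ
  obtain ⟨⟨hφs, hφq⟩, hext⟩ := hφ
  refine ⟨φ, ⟨hφs, ?_⟩, hφq⟩
  rintro ⟨p, hpa⟩ hp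
  by_contra! hne
  obtain ⟨hne0, hne1⟩ := hne
  have h1M : (1 : A) ∈ b.bicommutantSubmodule a :=
    (mem_bicommutantSubmodule hb).2 (one_mem_bicommutant hb)
  have hp' := compl_mem hp
  have hpa' : 1 - p ∈ b.bicommutantSubmodule a := Submodule.sub_mem _ h1M hpa
  have hcompl : φ ⟨1 - p, hpa'⟩ = 1 - φ ⟨p, hpa⟩ := by
    have := map_sub hφs ⟨1, h1M⟩ ⟨p, hpa⟩
    rwa [hφs.2.2.2 ⟨1, h1M⟩ rfl] at this
  have hne' : φ ⟨1 - p, hpa'⟩ ≠ 0 := by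
    rw [hcompl]; exact sub_ne_zero.2 (Ne.symm hne1)
  have hs₁ := state_conditional hb hφs hp hpa hne0
  have hs₂ := state_conditional hb hφs hp' hpa' hne'
  set φ₁ : b.bicommutantSubmodule a → ℝ := fun x => (φ ⟨p, hpa⟩)⁻¹ * φ ⟨b.J p x, _⟩
  set φ₂ : b.bicommutantSubmodule a → ℝ := fun x => (φ ⟨1 - p, hpa'⟩)⁻¹ * φ ⟨b.J (1 - p) x, _⟩
  have ht0 : 0 ≤ φ ⟨p, hpa⟩ := hφs.2.2.1 _ (effect_of_mem hp).1
  have ht1 : 0 ≤ φ ⟨1 - p, hpa'⟩ := hφs.2.2.1 _ (effect_of_mem hp').1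
  have hcomb : ∀ x, φ ⟨p, hpa⟩ * φ₁ x + φ ⟨1 - p, hpa'⟩ * φ₂ x = φ x := by
    intro x
    have hx : (x : A) ∈ b.projCommutant p := mem_projCommutant_of_mem_bicommutant hb hp
      ((mem_bicommutantSubmodule hb).1 hpa) ((mem_bicommutantSubmodule hb).1 x.2)
    simp only [φ₁, φ₂, mul_inv_cancel_left₀ hne0, mul_inv_cancel_left₀ hne']
    rw [← map_add hφs]
    congr 1
    exact Subtype.ext hx.symm
  have hle : ∀ ψ ∈ b.bicommutantStates a, ψ ⟨q, hqa⟩ ≤ 1 := by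
    intro ψ hψ
    rw [← hψ.2.2.2 ⟨1, h1M⟩ rfl]
    exact mono hψ (effect_of_mem hq).2
  have hq1 := hcomb ⟨q, hqa⟩
  have l₁ := hle _ hs₁
  have l₂ := hle _ hs₂
  have hφq' : φ ⟨q, hqa⟩ = 1 := hφq
  rw [hφq', hcompl] at hq1
  rw [hcompl] at ht1 hne'
  have hpos : 0 < φ ⟨p, hpa⟩ := lt_of_le_of_ne ht0 (Ne.symm hne0)
  have hpos' : 0 < 1 - φ ⟨p, hpa⟩ := lt_of_le_of_ne ht1 (Ne.symm hne')
  have e₁ : φ₁ ⟨q, hqa⟩ = 1 := by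
    refine le_antisymm l₁ ?_
    by_contra! hlt
    nlinarith [mul_lt_mul_of_pos_left hlt hpos, mul_le_mul_of_nonneg_left l₂ hpos'.le]
  have e₂ : φ₂ ⟨q, hqa⟩ = 1 := by
    refine le_antisymm l₂ ?_
    by_contra! hlt
    nlinarith [mul_lt_mul_of_pos_left hlt hpos', mul_le_mul_of_nonneg_left l₁ hpos.le]
  have heq := (hext φ₁ ⟨hs₁, e₁⟩ φ₂ ⟨hs₂, e₂⟩ ⟨φ ⟨p, hpa⟩, 1 - φ ⟨p, hpa⟩, hpos, hpos', by ring,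
    by
      ext x
      rw [← hcomb x, hcompl]
      rfl⟩).1
  have h1 : φ₁ ⟨p, hpa⟩ = 1 := by
    simp only [φ₁, J_self hp]
    exact inv_mul_cancel₀ hne0
  rw [heq] at h1
  exact hne1 h1

/-- A state that vanishes at a projection vanishes on the range of its compression. -/
theorem character_J_eq_zero {φ : b.bicommutantSubmodule a → ℝ}
    (hφ : φ ∈ b.bicommutantStates a) (hp : p ∈ b.proj) (hpa : p ∈ b.bicommutantSubmodule a)
    (h0 : φ ⟨p, hpa⟩ = 0) (x : b.bicommutantSubmodule a)
    (hx : b.J p x ∈ b.bicommutantSubmodule a) : φ ⟨b.J p x, hx⟩ = 0 := by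
  apply le_antisymm
  · have := mono hφ (x := ⟨b.J p x, hx⟩) (y := ‖x‖ • ⟨p, hpa⟩) (by
      have := J_mono hp (le_norm_smul_one (x : A))
      rwa [_root_.map_smul, J_one hp] at this)
    rwa [map_smul hφ, h0, mul_zero] at this
  · have := mono hφ (y := ⟨b.J p x, hx⟩) (x := (-‖x‖) • ⟨p, hpa⟩) (by
      have := J_mono hp (neg_norm_smul_one_le (x : A))
      rw [map_neg, _root_.map_smul, J_one hp, ← neg_smul] at this
      exact this)
    rwa [map_smul hφ, h0, mul_zero] at this

/-- The spectral projections of `x` bound the values of characters at `x`. -/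
theorem exists_projection_character (hb : b.HasComparability) (x : b.bicommutantSubmodule a)
    (t : ℝ) : ∃ p : b.bicommutantSubmodule a, (p : A) ∈ b.projBicommutant x ∧
      b.J (1 - p) x ≤ t • (1 - p : A) ∧ t • (p : A) ≤ b.J p x ∧
      ∀ φ ∈ b.bicommutantCharacters a, (φ p = 1 → t ≤ φ x) ∧ (φ p = 0 → φ x ≤ t) := by
  obtain ⟨p, hp, h₁, h₂⟩ := exists_projection_comparability hb (x : A) t
  have hxa := (mem_bicommutantSubmodule hb).1 x.2
  have h1M : (1 : A) ∈ b.bicommutantSubmodule a :=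
    (mem_bicommutantSubmodule hb).2 (one_mem_bicommutant hb)
  have hpb := projBicommutant_subset_bicommutant hb hxa hp
  have hpa : p ∈ b.bicommutantSubmodule a := (mem_bicommutantSubmodule hb).2 hpb
  have hpP := (mem_projBicommutant.1 hp).1
  have hpa' : 1 - p ∈ b.bicommutantSubmodule a := Submodule.sub_mem _ h1M hpa
  have hJ : b.J p x ∈ b.bicommutantSubmodule a :=
    (mem_bicommutantSubmodule hb).2 (J_mem_bicommutant hb hpP hpb hxa)
  have hJ' : b.J (1 - p) x ∈ b.bicommutantSubmodule a := (mem_bicommutantSubmodule hb).2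
    (J_mem_bicommutant hb (compl_mem hpP) ((mem_bicommutantSubmodule hb).1 hpa') hxa)
  refine ⟨⟨p, hpa⟩, hp, h₁, h₂, fun φ hφ => ?_⟩
  have hcompl : φ ⟨1 - p, hpa'⟩ = 1 - φ ⟨p, hpa⟩ := by
    have := map_sub hφ.1 ⟨1, h1M⟩ ⟨p, hpa⟩
    rwa [hφ.1.2.2.2 ⟨1, h1M⟩ rfl] at this
  have hsplit : φ x = φ ⟨b.J p x, hJ⟩ + φ ⟨b.J (1 - p) x, hJ'⟩ := by
    rw [← map_add hφ.1]
    exact congrArg φ (Subtype.ext (mem_projBicommutant.1 hp).2.1)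
  constructor
  · intro h
    rw [hsplit, character_J_eq_zero hφ.1 (compl_mem hpP) hpa' (by rw [hcompl, h, sub_self]) x,
      add_zero]
    have := mono hφ.1 (x := t • ⟨p, hpa⟩) (y := ⟨b.J p x, hJ⟩) h₂
    rwa [map_smul hφ.1, h, mul_one] at this
  · intro h
    rw [hsplit, character_J_eq_zero hφ.1 hpP hpa h x, zero_add]
    have := mono hφ.1 (x := ⟨b.J (1 - p) x, hJ'⟩) (y := t • ⟨1 - p, hpa'⟩) h₁
    rwa [map_smul hφ.1, hcompl, h, sub_zero, mul_one] at this

/-! ### The representation of `CC(a)` by continuous functions -/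

/-- Evaluation of the elements of `CC(a)` at characters. -/
def gelfandMap (b : CompressionBase A) (a : A) :
    b.bicommutantSubmodule a →ₗ[ℝ] C(b.bicommutantCharacters a, ℝ) where
  toFun x := ⟨fun φ => φ.1 x, (continuous_apply x).comp continuous_subtype_val⟩
  map_add' x y := by ext φ; exact map_add φ.2.1 x y
  map_smul' t x := by ext φ; exact map_smul φ.2.1 t x

theorem gelfandMap_apply (x : b.bicommutantSubmodule a) (φ : b.bicommutantCharacters a) :
    b.gelfandMap a x φ = φ.1 x := rfl

theorem gelfandMap_nonneg_iff (hb : b.HasComparability) (x : b.bicommutantSubmodule a) :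
    0 ≤ b.gelfandMap a x ↔ 0 ≤ (x : A) := by
  constructor
  swap
  · exact fun hx φ => φ.2.1.2.2.1 x hx
  intro h
  refine le_of_forall_pos_le_add_smul_one fun ε hε => ?_
  have h1M : (1 : A) ∈ b.bicommutantSubmodule a :=
    (mem_bicommutantSubmodule hb).2 (one_mem_bicommutant hb)
  -- A cut at 0 would only give `φ x ≤ 0`. At `-ε`, a character supported by a nonzero `1 - p` would
  -- be strictly negative at `x`; so `p = 1` and `x ≥ -ε • 1`.
  obtain ⟨p, hp, h₁, h₂, h₃⟩ := exists_projection_character hb x (-ε)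
  have hpP := (mem_projBicommutant.1 hp).1
  have hpa' : 1 - (p : A) ∈ b.bicommutantSubmodule a := Submodule.sub_mem _ h1M p.2
  have hp1 : 1 - (p : A) = 0 := by
    by_contra hne
    obtain ⟨φ, hφ, hφp⟩ := exists_character hb (compl_mem hpP) hpa' hne
    have hcompl : φ ⟨1 - p, hpa'⟩ = 1 - φ p := by
      have := map_sub hφ.1 ⟨1, h1M⟩ p
      rwa [hφ.1.2.2.2 ⟨1, h1M⟩ rfl] at this
    have h4 := (h₃ φ hφ).2 (by linarith)
    have h5 : 0 ≤ φ x := h ⟨φ, hφ⟩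
    linarith
  have hx : (x : A) = b.J p x + b.J (1 - p) x := (mem_projBicommutant.1 hp).2.1
  have hz : b.J (1 - (p : A)) x = 0 := by
    have h6 := J_mono (compl_mem hpP) (neg_norm_smul_one_le (x : A))
    have h7 := J_mono (compl_mem hpP) (le_norm_smul_one (x : A))
    rw [map_neg, _root_.map_smul, J_one (compl_mem hpP)] at h6
    rw [_root_.map_smul, J_one (compl_mem hpP)] at h7
    nth_rewrite 1 [hp1] at h6
    nth_rewrite 2 [hp1] at h7
    rw [smul_zero] at h6 h7
    rw [neg_zero] at h6
    exact le_antisymm h7 h6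
  rw [hz, add_zero] at hx
  rw [← hx, ← (sub_eq_zero.1 hp1), neg_smul, neg_le_iff_add_nonneg] at h₂
  exact h₂

theorem gelfandMap_le_iff (hb : b.HasComparability) (x y : b.bicommutantSubmodule a) :
    b.gelfandMap a x ≤ b.gelfandMap a y ↔ (x : A) ≤ y := by
  rw [← sub_nonneg, ← _root_.map_sub, gelfandMap_nonneg_iff hb]
  simp

theorem gelfandMap_injective (hb : b.HasComparability) : Function.Injective (b.gelfandMap a) :=
  fun x y h => Subtype.ext (le_antisymm ((gelfandMap_le_iff hb x y).1 h.le)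
    ((gelfandMap_le_iff hb y x).1 h.ge))

theorem gelfandMap_one (x : b.bicommutantSubmodule a) (hx : (x : A) = 1) :
    b.gelfandMap a x = 1 := by
  ext φ
  exact φ.2.1.2.2.2 x hx

theorem compactSpace_bicommutantCharacters (hb : b.HasComparability) (a : A) :
    CompactSpace (b.bicommutantCharacters a) :=
  isCompact_iff_compactSpace.1 (isCompact_bicommutantCharacters hb a)

theorem isometry_gelfandMap (hb : b.HasComparability) [CompactSpace (b.bicommutantCharacters a)] :
    Isometry (b.gelfandMap a) := by
  refine AddMonoidHomClass.isometry_of_norm _ fun x => le_antisymm ?_ ?_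
  · refine (ContinuousMap.norm_le _ (norm_nonneg _)).2 fun φ => ?_
    exact abs_le.2 (abs_le_norm hb φ.2.1 x)
  · have h1M : (1 : A) ∈ b.bicommutantSubmodule a :=
      (mem_bicommutantSubmodule hb).2 (one_mem_bicommutant hb)
    have h1 := gelfandMap_one ⟨1, h1M⟩ rfl
    refine norm_le_of_bounds (x := (x : A)) (norm_nonneg _) ?_ ?_
    · refine (gelfandMap_le_iff hb (-(‖b.gelfandMap a x‖ • ⟨1, h1M⟩)) x).1 fun φ => ?_
      rw [map_neg, _root_.map_smul, h1]
      simpa using (abs_le.1 ((b.gelfandMap a x).norm_coe_le_norm φ)).1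
    · refine (gelfandMap_le_iff hb x (‖b.gelfandMap a x‖ • ⟨1, h1M⟩)).1 fun φ => ?_
      rw [_root_.map_smul, h1]
      simpa using (abs_le.1 ((b.gelfandMap a x).norm_coe_le_norm φ)).2

theorem exists_projection_separating (hb : b.HasComparability)
    {φ ψ : b.bicommutantCharacters a} (h : φ ≠ ψ) :
    ∃ p : b.bicommutantSubmodule a, (p : A) ∈ b.proj ∧ φ.1 p ≠ ψ.1 p := by
  have aux : ∀ (φ ψ : b.bicommutantCharacters a) (x : b.bicommutantSubmodule a),
      φ.1 x < ψ.1 x → ∃ p : b.bicommutantSubmodule a, (p : A) ∈ b.proj ∧ φ.1 p ≠ ψ.1 p := by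
    intro φ ψ x hx
    -- With a cut at the midpoint, equal values at `p` would put both numbers on the same side of
    -- it.
    obtain ⟨p, hp, -, -, h⟩ := exists_projection_character hb x ((φ.1 x + ψ.1 x) / 2)
    have hpP := (mem_projBicommutant.1 hp).1
    refine ⟨p, hpP, ?_⟩
    have h₁ := h φ φ.2
    have h₂ := h ψ ψ.2
    rcases φ.2.2 p hpP with e | e <;> rcases ψ.2.2 p hpP with e' | e' <;> rw [e, e']
    · have := h₂.2 e'
      exfalso; linarith
    · exact zero_ne_one
    · exact one_ne_zero
    · have := h₁.1 e
      exfalso; linarith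
  have hne : φ.1 ≠ ψ.1 := fun e => h (Subtype.ext e)
  obtain ⟨x, hx⟩ := Function.ne_iff.1 hne
  rcases lt_or_gt_of_ne hx with hlt | hlt
  · exact aux φ ψ x hlt
  · obtain ⟨p, hp, h'⟩ := aux ψ φ x hlt
    exact ⟨p, hp, h'.symm⟩

theorem isClopen_character_eq_one {p : b.bicommutantSubmodule a} (hp : (p : A) ∈ b.proj) :
    IsClopen {φ : b.bicommutantCharacters a | φ.1 p = 1} := by
  have hc : Continuous fun φ : b.bicommutantCharacters a => φ.1 p :=
    (continuous_apply p).comp continuous_subtype_val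
  refine ⟨isClosed_eq hc continuous_const, ?_⟩
  have : {φ : b.bicommutantCharacters a | φ.1 p = 1} = {φ | φ.1 p = 0}ᶜ := by
    ext φ
    have := φ.2.2 p hp
    simp only [Set.mem_ofPred_eq, Set.mem_compl_iff]
    constructor
    · intro h; rw [h]; exact one_ne_zero
    · intro h; exact this.resolve_left h
  rw [this]
  exact (isClosed_eq hc continuous_const).isOpen_compl

theorem totallyDisconnectedSpace_bicommutantCharacters (hb : b.HasComparability) (a : A) :
    TotallyDisconnectedSpace (b.bicommutantCharacters a) := by
  have : TotallySeparatedSpace (b.bicommutantCharacters a) := by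
    rw [totallySeparatedSpace_iff_exists_isClopen]
    intro φ ψ h
    obtain ⟨p, hp, hne⟩ := exists_projection_separating hb h
    have hcl := isClopen_character_eq_one hp
    rcases φ.2.2 p hp with e | e
    · refine ⟨_, hcl.compl, ?_, ?_⟩
      · simp [e]
      · have := (ψ.2.2 p hp).resolve_left fun e' => hne (e.trans e'.symm)
        simp [this]
    · refine ⟨_, hcl, ?_, ?_⟩
      · simp [e]
      · have := (ψ.2.2 p hp).resolve_right fun e' => hne (e.trans e'.symm)
        simp [this]
  infer_instance

/-- The functions on characters defined by the projections in `CC(a)`. -/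
def projectionFunctions (hb : b.HasComparability) (a : A) :
    Submonoid C(b.bicommutantCharacters a, ℝ) where
  carrier := {f | ∃ p : b.bicommutantSubmodule a, (p : A) ∈ b.proj ∧ b.gelfandMap a p = f}
  one_mem' := ⟨⟨1, (mem_bicommutantSubmodule hb).2 (one_mem_bicommutant hb)⟩,
    b.normalSubalgebra.one_mem, gelfandMap_one _ rfl⟩
  mul_mem' := by
    rintro _ _ ⟨p, hp, rfl⟩ ⟨q, hq, rfl⟩
    have hpa := (mem_bicommutantSubmodule hb).1 p.2
    have hqa := (mem_bicommutantSubmodule hb).1 q.2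
    have hqp := mem_projCommutant_of_mem_bicommutant hb hp hpa hqa
    have h1M : (1 : A) ∈ b.bicommutantSubmodule a :=
      (mem_bicommutantSubmodule hb).2 (one_mem_bicommutant hb)
    have hpa' : 1 - (p : A) ∈ b.bicommutantSubmodule a := Submodule.sub_mem _ h1M p.2
    have hJ : b.J p q ∈ b.bicommutantSubmodule a :=
      (mem_bicommutantSubmodule hb).2 (J_mem_bicommutant hb hp hpa hqa)
    have hJ' : b.J (1 - p) q ∈ b.bicommutantSubmodule a := (mem_bicommutantSubmodule hb).2
      (J_mem_bicommutant hb (compl_mem hp) ((mem_bicommutantSubmodule hb).1 hpa') hqa)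
    refine ⟨⟨b.J p q, hJ⟩, meet_mem hp hq hqp, ?_⟩
    ext φ
    rw [ContinuousMap.mul_apply]
    simp only [gelfandMap_apply]
    -- The product is represented by the meet `J_p q`: where `φ p = 0` both sides vanish, and where
    -- `φ p = 1` the part of `q` under `1 - p` contributes nothing.
    rcases φ.2.2 p hp with e | e
    · rw [e, zero_mul]
      exact character_J_eq_zero φ.2.1 hp p.2 e q hJ
    · have hcompl : φ.1 ⟨1 - p, hpa'⟩ = 1 - φ.1 p := by
        have := map_sub φ.2.1 ⟨1, h1M⟩ p
        rwa [φ.2.1.2.2.2 ⟨1, h1M⟩ rfl] at this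
      have h0 := character_J_eq_zero φ.2.1 (compl_mem hp) hpa' (by rw [hcompl, e, sub_self]) q hJ'
      have hsplit : φ.1 q = φ.1 ⟨b.J p q, hJ⟩ + φ.1 ⟨b.J (1 - p) q, hJ'⟩ := by
        rw [← map_add φ.2.1]
        exact congrArg φ.1 (Subtype.ext hqp)
      rw [hsplit, h0, e, add_zero, one_mul]

/-- Projection functions are closed under products, so the algebra they generate is just their span
and lies in the range. It is dense by Stone–Weierstrass, and the range is closed as an isometric
image of a complete space. -/
theorem gelfandMap_surjective [CompleteSpace A] (hb : b.HasComparability) :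
    Function.Surjective (b.gelfandMap a) := by
  have := compactSpace_bicommutantCharacters hb a
  have : CompleteSpace (b.bicommutantSubmodule a) :=
    (isClosed_bicommutantSubmodule b a).completeSpace_coe
  have hclosed : IsClosed (Set.range (b.gelfandMap a)) :=
    (isometry_gelfandMap hb).isClosedEmbedding.isClosed_range
  have htop := ContinuousMap.subalgebra_topologicalClosure_eq_top_of_separatesPoints
    (Algebra.adjoin ℝ (projectionFunctions hb a : Set C(b.bicommutantCharacters a, ℝ))) (by
      intro φ ψ h
      obtain ⟨p, hp, hne⟩ := exists_projection_separating hb h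
      exact ⟨_, ⟨b.gelfandMap a p, Algebra.subset_adjoin ⟨p, hp, rfl⟩, rfl⟩, hne⟩)
  have hsub : (Algebra.adjoin ℝ
      (projectionFunctions hb a : Set C(b.bicommutantCharacters a, ℝ)) : Set _) ⊆
      Set.range (b.gelfandMap a) := by
    have h := Algebra.adjoin_eq_span ℝ
      (projectionFunctions hb a : Set C(b.bicommutantCharacters a, ℝ))
    rw [Submonoid.closure_eq] at h
    have h2 : Submodule.span ℝ (projectionFunctions hb a : Set C(b.bicommutantCharacters a, ℝ)) ≤
        LinearMap.range (b.gelfandMap a) := by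
      rw [Submodule.span_le]
      rintro _ ⟨p, -, rfl⟩
      exact ⟨p, rfl⟩
    intro f hf
    exact h2 (h ▸ hf : f ∈ Submodule.span ℝ _)
  intro f
  have hf : f ∈ (Algebra.adjoin ℝ
      (projectionFunctions hb a : Set C(b.bicommutantCharacters a, ℝ))).topologicalClosure := by
    rw [htop]; trivial
  exact closure_minimal hsub hclosed hf

/-- The inverse of the isomorphism of `CC(a)` with the continuous functions on its characters. -/
noncomputable def gelfandInv [CompleteSpace A] (hb : b.HasComparability) (a : A) :
    C(b.bicommutantCharacters a, ℝ) →ₗ[ℝ] A :=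
  (b.bicommutantSubmodule a).subtype ∘ₗ
    (LinearEquiv.ofBijective (b.gelfandMap a)
      ⟨gelfandMap_injective hb, gelfandMap_surjective hb⟩).symm.toLinearMap

theorem gelfandInv_gelfandMap [CompleteSpace A] (hb : b.HasComparability)
    (x : b.bicommutantSubmodule a) : gelfandInv hb a (b.gelfandMap a x) = x :=
  congrArg Subtype.val ((LinearEquiv.ofBijective (b.gelfandMap a)
      ⟨gelfandMap_injective hb, gelfandMap_surjective hb⟩).symm_apply_apply x)

theorem isFunctionRep_gelfandInv [CompleteSpace A] (hb : b.HasComparability) (a : A) :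
    b.IsFunctionRep a (gelfandInv hb a) where
  map_one := by
    rw [← gelfandMap_one ⟨1, (mem_bicommutantSubmodule hb).2 (one_mem_bicommutant hb)⟩ rfl,
      gelfandInv_gelfandMap]
  le_iff_le f g := by
    obtain ⟨x, rfl⟩ := gelfandMap_surjective hb f
    obtain ⟨y, rfl⟩ := gelfandMap_surjective hb g
    rw [gelfandInv_gelfandMap, gelfandInv_gelfandMap, gelfandMap_le_iff hb]
  range_eq := by
    ext x
    constructor
    · rintro ⟨f, rfl⟩
      obtain ⟨x, rfl⟩ := gelfandMap_surjective hb f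
      rw [gelfandInv_gelfandMap]
      exact (mem_bicommutantSubmodule hb).1 x.2
    · intro hx
      exact ⟨b.gelfandMap a ⟨x, (mem_bicommutantSubmodule hb).2 hx⟩, gelfandInv_gelfandMap hb _⟩

end CompressionBase

/-! ### Continuous functions modulo meagre sets -/

open Filter Topology

/-- The inequality holds on a closed set, which is dense by Baire's theorem. This lets relations
valid off a meagre set pass to continuous representatives. -/
theorem ContinuousMap.le_of_eventually_residual {X : Type*} [TopologicalSpace X] [BaireSpace X]
    {g k : C(X, ℝ)} (h : ∀ᶠ x in residual X, g x ≤ k x) : g ≤ k := by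
  have hd : Dense {x | g x ≤ k x} := dense_of_mem_residual h
  have hc : IsClosed {x | g x ≤ k x} := isClosed_le g.continuous k.continuous
  intro x
  have := hd x
  rwa [hc.closure_eq] at this

theorem ContinuousMap.eq_of_eventually_residual {X : Type*} [TopologicalSpace X] [BaireSpace X]
    {g k : C(X, ℝ)} (h : ∀ᶠ x in residual X, g x = k x) : g = k :=
  le_antisymm (le_of_eventually_residual (h.mono fun _ => le_of_eq))
    (le_of_eventually_residual (h.mono fun _ => ge_of_eq))

/-! ### Spectrum and Borel functions in a representation -/

namespace CompressionBase

open OrderUnitSpace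

section FunctionRep

variable {A : Type*} [NormedAddCommGroup A] [NormedSpace ℝ A] [PartialOrder A]
    [IsOrderedAddMonoid A] [IsOrderedModule ℝ A] [One A] [OrderUnitSpace A]
    {b : CompressionBase A} {a : A} {X : Type*} [TopologicalSpace X] [CompactSpace X]
    {ι : C(X, ℝ) →ₗ[ℝ] A} {f : C(X, ℝ)}

/-- The range of the function representing `a` is determined by the ordered space `CC(a)`. -/
theorem IsFunctionRep.mem_range_iff (hι : b.IsFunctionRep a ι) (hf : ι f = a) (t : ℝ) :
    t ∈ Set.range f ↔ ∀ ε : ℝ, 0 < ε → ∃ y ∈ b.bicommutant a,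
      a - t • (1 : A) ≤ y ∧ t • (1 : A) - a ≤ y ∧ ¬ ε • (1 : A) ≤ y := by
  have h₁ : a - t • (1 : A) = ι (f - t • 1) := by rw [map_sub, map_smul, hι.map_one, hf]
  have h₂ : t • (1 : A) - a = ι (t • 1 - f) := by rw [map_sub, map_smul, hι.map_one, hf]
  have h₃ : ∀ ε : ℝ, ε • (1 : A) = ι (ε • 1) := fun ε => by rw [map_smul, hι.map_one]
  constructor
  · rintro ⟨x, rfl⟩ ε hε
    -- This function vanishes at `x`, so it is not bounded below by `ε`.
    refine ⟨ι |f - f x • 1|, hι.range_eq ▸ ⟨_, rfl⟩, ?_, ?_, ?_⟩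
    · rw [h₁, hι.le_iff_le]
      exact le_abs_self _
    · rw [h₂, hι.le_iff_le, ← neg_sub]
      exact neg_le_abs _
    · rw [h₃, hι.le_iff_le]
      intro h
      have := h x
      simp at this
      linarith
  · intro h
    by_contra hne
    have hcl : IsClosed (Set.range f) := (isCompact_range f.continuous).isClosed
    -- An `ε`-ball around `t` misses the compact range, so `|f - t| ≥ ε` and every upper bound of
    -- `±(a - t • 1)` is at least `ε • 1`.
    obtain ⟨ε, hε, hball⟩ := Metric.isOpen_iff.1 hcl.isOpen_compl t hne
    obtain ⟨y, hy, hy₁, hy₂, hy₃⟩ := h ε hε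
    rw [← hι.range_eq] at hy
    obtain ⟨g, rfl⟩ := hy
    rw [h₁, hι.le_iff_le] at hy₁
    rw [h₂, hι.le_iff_le] at hy₂
    rw [h₃, hι.le_iff_le] at hy₃
    refine hy₃ fun x => ?_
    have hx : ε ≤ |f x - t| := by
      by_contra! hlt
      exact hball (by rwa [Metric.mem_ball, Real.dist_eq]) ⟨x, rfl⟩
    have e₁ : f x - t * 1 ≤ g x := hy₁ x
    have e₂ : t * 1 - f x ≤ g x := hy₂ x
    change ε * 1 ≤ g x
    rw [mul_one] at *
    exact hx.trans (abs_le'.2 ⟨e₁, by rwa [neg_sub]⟩)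

theorem IsFunctionRep.injective (hι : b.IsFunctionRep a ι) : Function.Injective ι :=
  fun f g h => le_antisymm ((hι.le_iff_le f g).1 h.le) ((hι.le_iff_le g f).1 h.ge)

variable [T2Space X]

/-- Countable suprema in `P(a)` are represented by countable unions up to a meagre set. -/
theorem IsFunctionRep.exists_iUnion [CompleteSpace A] (hb : b.IsSpectral)
    (hι : b.IsFunctionRep a ι) (hproj : ∀ g, ι g ∈ b.proj → ∀ x, g x = 0 ∨ g x = 1)
    {g : ℕ → C(X, ℝ)} (hg : ∀ n, ι (g n) ∈ b.projBicommutant a) :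
    ∃ k, ι k ∈ b.projBicommutant a ∧ ∀ᶠ x in residual X, (k x = 1 ↔ ∃ n, g n x = 1) := by
  obtain ⟨s, hs, hle, hsup⟩ := exists_projBicommutant_sup hb hg
  have hsP := (mem_projBicommutant.1 hs).1
  have hgP := fun n => (mem_projBicommutant.1 (hg n)).1
  have hs' := projBicommutant_subset_bicommutant hb.2 (self_mem_bicommutant a) hs
  rw [← hι.range_eq] at hs'
  obtain ⟨k, rfl⟩ := hs'
  have hgk : ∀ n, g n ≤ k := fun n => (hι.le_iff_le _ _).1 (hle n)
  have hk1 : ∀ x n, g n x = 1 → k x = 1 := fun x n h =>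
    (hproj k hsP x).resolve_left fun h0 => by
      have : g n x ≤ k x := hgk n x
      rw [h, h0] at this
      linarith
  have hopen : ∀ h : C(X, ℝ), ι h ∈ b.proj → IsOpen {x | h x = 1} := by
    intro h hh
    have : {x | h x = 1} = {x | 0 < h x} := by
      ext x
      rcases hproj h hh x with e | e <;> simp [e]
    rw [this]
    exact isOpen_lt continuous_const h.continuous
  -- The complement of `D` is the gap between the clopen set of the supremum and the union; it must
  -- be shown to be nowhere dense.
  set D : Set X := (⋃ n, {x | g n x = 1}) ∪ {x | k x = 1}ᶜ
  have hDo : IsOpen D := (isOpen_iUnion fun n => hopen _ (hgP n)).union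
    (isClosed_eq k.continuous continuous_const).isOpen_compl
  have hDd : Dense D := by
    intro x
    by_contra hx
    -- If `D` is not dense, Urysohn gives a nonzero `u` living in the gap. The cover `q` of `ι u` is
    -- orthogonal to every `ι (g n)`, so the supremum `ι k` is below `1 - q`. Then `ι u` is below
    -- both `ι k` and `1 - ι k`, hence zero.
    obtain ⟨u, hu0, hu1, hu⟩ := exists_continuous_zero_one_of_isClosed (isClosed_closure (s := D))
      (isClosed_singleton (x := x)) (Set.disjoint_singleton_right.2 hx)
    have huD : ∀ z ∈ D, u z = 0 := fun z hz => hu0 (subset_closure hz)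
    have hu_k : u ≤ k := by
      intro z
      change u z ≤ k z
      rcases hproj k hsP z with e | e
      · rw [e, huD z (Or.inr (by simp [e]))]
      · rw [e]; exact (hu z).2
    have hu_g : ∀ n, u ≤ 1 - g n := by
      intro n z
      change u z ≤ 1 - g n z
      rcases hproj _ (hgP n) z with e | e
      · rw [e, sub_zero]; exact (hu z).2
      · rw [e, sub_self, huD z (Or.inl (Set.mem_iUnion.2 ⟨n, e⟩))]
    have hy0 : 0 ≤ ι u := by
      rw [← map_zero ι, hι.le_iff_le]
      exact fun z => (hu z).1
    have hyk : ι u ≤ ι k := (hι.le_iff_le _ _).2 hu_k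
    obtain ⟨q, hq, hcov⟩ := hb.1 (ι u) ⟨hy0, hyk.trans (effect_of_mem hsP).2⟩
    have hqn : ∀ n, ι (g n) ≤ 1 - q := by
      intro n
      have : ι u ≤ 1 - ι (g n) := by
        rw [← hι.map_one, ← map_sub, hι.le_iff_le]
        exact hu_g n
      rw [le_sub_comm]
      exact (hcov _ (compl_mem (hgP n))).1 this
    have hyk' : ι u ≤ 1 - ι k := by
      refine ((hcov q hq).2 le_rfl).trans ?_
      rw [le_sub_comm]
      exact hsup _ (compl_mem hq) hqn
    have h0 : ι u = 0 := (J_of_le hsP hy0 hyk).symm.trans (J_of_le_compl hsP hy0 hyk')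
    have hu0 : u = 0 := hι.injective (by rw [h0, map_zero])
    have h1 : u x = 1 := hu1 rfl
    rw [hu0, ContinuousMap.zero_apply] at h1
    exact zero_ne_one h1
  refine ⟨k, hs, ?_⟩
  filter_upwards [residual_of_dense_open hDo hDd] with x hx
  constructor
  · intro h
    rcases hx with hx | hx
    · simpa using hx
    · exact absurd h hx
  · rintro ⟨n, hn⟩
    exact hk1 x n hn

/-- Preimages of Borel sets under the function representing `a` are given by projections in `P(a)`,
up to meagre sets. -/
theorem IsFunctionRep.exists_preimage [CompleteSpace A] (hb : b.IsSpectral)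
    (hι : b.IsFunctionRep a ι) (hproj : ∀ g, ι g ∈ b.proj → ∀ x, g x = 0 ∨ g x = 1)
    (hspec : ∀ t : ℝ, ∃ g, ι g ∈ b.projBicommutant a ∧
      ∀ x, (g x = 1 → t ≤ f x) ∧ (g x = 0 → f x ≤ t)) (B : Set ℝ) (hB : MeasurableSet B) :
    ∃ g, ι g ∈ b.projBicommutant a ∧ ∀ᶠ x in residual X, (g x = 1 ↔ f x ∈ B) := by
  have h1 : ι 1 ∈ b.projBicommutant a := hι.map_one ▸ one_mem_projBicommutant
  have hcompl : ∀ B : Set ℝ, (∃ g, ι g ∈ b.projBicommutant a ∧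
      ∀ᶠ x in residual X, (g x = 1 ↔ f x ∈ B)) → ∃ g, ι g ∈ b.projBicommutant a ∧
      ∀ᶠ x in residual X, (g x = 1 ↔ f x ∈ Bᶜ) := by
    rintro B ⟨g, hg, h⟩
    refine ⟨1 - g, ?_, ?_⟩
    · rw [map_sub, hι.map_one]
      exact compl_mem_projBicommutant hg
    · filter_upwards [h] with x hx
      rw [Set.mem_compl_iff, ← hx]
      rcases hproj g (mem_projBicommutant.1 hg).1 x with e | e <;> simp [e]
  have hunion : ∀ B : ℕ → Set ℝ, (∀ n, ∃ g, ι g ∈ b.projBicommutant a ∧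
      ∀ᶠ x in residual X, (g x = 1 ↔ f x ∈ B n)) → ∃ g, ι g ∈ b.projBicommutant a ∧
      ∀ᶠ x in residual X, (g x = 1 ↔ f x ∈ ⋃ n, B n) := by
    intro B h
    choose g hg hgB using h
    obtain ⟨k, hk, hk'⟩ := hι.exists_iUnion hb hproj hg
    refine ⟨k, hk, ?_⟩
    filter_upwards [hk', eventually_countable_forall.2 hgB] with x hx hx'
    rw [hx, Set.mem_iUnion]
    exact exists_congr hx'
  have hempty : ∃ g, ι g ∈ b.projBicommutant a ∧
      ∀ᶠ x in residual X, (g x = 1 ↔ f x ∈ (∅ : Set ℝ)) := by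
    rw [← Set.compl_univ]
    exact hcompl _ ⟨1, h1, Eventually.of_forall fun x => by simp⟩
  have hmeas : MeasurableSpace.generateFrom (Set.range (Set.Ioi : ℝ → Set ℝ)) =
      (inferInstance : MeasurableSpace ℝ) := by
    rw [← borel_eq_generateFrom_Ioi, ← BorelSpace.measurable_eq]
  replace hB : @MeasurableSet ℝ (MeasurableSpace.generateFrom (Set.range Set.Ioi)) B := by
    rwa [hmeas]
  refine MeasurableSpace.generateFrom_induction _ (fun B _ => ∃ g, ι g ∈ b.projBicommutant a ∧
      ∀ᶠ x in residual X, (g x = 1 ↔ f x ∈ B)) ?_ hempty (fun B _ => hcompl B)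
      (fun B _ => hunion B) B hB
  rintro _ ⟨t, rfl⟩ -
  -- Cuts give only non-strict inequalities, so the open ray is exhausted by cuts at levels slightly
  -- above `t`.
  choose g hg h using fun n : ℕ => hspec (t + 1 / ((n : ℝ) + 1))
  obtain ⟨k, hk, hk'⟩ := hι.exists_iUnion hb hproj hg
  refine ⟨k, hk, ?_⟩
  filter_upwards [hk'] with x hx
  rw [hx, Set.mem_Ioi]
  constructor
  · rintro ⟨n, hn⟩
    have := (h n x).1 hn
    have : 0 < 1 / ((n : ℝ) + 1) := by positivity
    linarith
  · intro hlt
    obtain ⟨n, hn⟩ := exists_nat_one_div_lt (sub_pos.2 hlt)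
    refine ⟨n, (hproj _ (mem_projBicommutant.1 (hg n)).1 x).resolve_left fun h0 => ?_⟩
    have := (h n x).2 h0
    linarith

/-- Composing a bounded Borel function with the function representing `a` gives a continuous
function up to a meagre set. -/
theorem IsFunctionRep.exists_continuous_eq_comp [CompleteSpace A] (hb : b.IsSpectral)
    (hι : b.IsFunctionRep a ι) (hproj : ∀ g, ι g ∈ b.proj → ∀ x, g x = 0 ∨ g x = 1)
    (hspec : ∀ t : ℝ, ∃ g, ι g ∈ b.projBicommutant a ∧
      ∀ x, (g x = 1 → t ≤ f x) ∧ (g x = 0 → f x ≤ t)) {S : Set ℝ} (hS : ∀ x, f x ∈ S)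
    (h : boundedBorel S) :
    ∃ g : C(X, ℝ), ∀ᶠ x in residual X, g x = h.1 ⟨f x, hS x⟩ := by
  obtain ⟨hm, M, hM⟩ := h.2
  set u : X → ℝ := fun x => h.1 ⟨f x, hS x⟩
  -- Uniform approximation by simple functions: round `u` down to a multiple of `1 / (n + 1)` and
  -- replace each level set by its clopen representative.
  have step : ∀ n : ℕ, ∃ G : C(X, ℝ), ∀ᶠ x in residual X, |G x - u x| ≤ 1 / ((n : ℝ) + 1) := by
    intro n
    have hn : (0 : ℝ) < (n : ℝ) + 1 := by positivity
    have hset : ∀ j : ℤ, ∃ g, ι g ∈ b.projBicommutant a ∧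
        ∀ᶠ x in residual X, (g x = 1 ↔ ⌊((n : ℝ) + 1) * u x⌋ = j) := by
      intro j
      have hmj : MeasurableSet {s : S | ⌊((n : ℝ) + 1) * h.1 s⌋ = j} :=
        (Int.measurable_floor.comp (hm.const_mul _)) (measurableSet_singleton j)
      obtain ⟨B, hB, hBe⟩ := hmj
      obtain ⟨g, hg, hgB⟩ := hι.exists_preimage hb hproj hspec B hB
      refine ⟨g, hg, hgB.mono fun x hx => hx.trans ?_⟩
      exact (Set.ext_iff.1 hBe ⟨f x, hS x⟩)
    choose g hg hgu using hset
    -- The extra 1 allows for the floor falling below `-(n + 1) * M`.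
    obtain ⟨N, hN⟩ := exists_nat_ge (((n : ℝ) + 1) * M + 1)
    refine ⟨∑ j ∈ Finset.Icc (-(N : ℤ)) N, ((j : ℝ) / ((n : ℝ) + 1)) • g j, ?_⟩
    filter_upwards [eventually_countable_forall.2 hgu] with x hx
    have hx0 : ∀ j, ⌊((n : ℝ) + 1) * u x⌋ ≠ j → g j x = 0 := fun j hj =>
      (hproj _ (mem_projBicommutant.1 (hg j)).1 x).resolve_right fun e => hj ((hx j).1 e)
    set m := ⌊((n : ℝ) + 1) * u x⌋
    have hMx := abs_le.1 (hM ⟨f x, hS x⟩)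
    have hle : (m : ℝ) ≤ ((n : ℝ) + 1) * u x := Int.floor_le _
    have hlt : ((n : ℝ) + 1) * u x < m + 1 := Int.lt_floor_add_one _
    have b₁ : ((n : ℝ) + 1) * u x ≤ ((n : ℝ) + 1) * M := mul_le_mul_of_nonneg_left hMx.2 hn.le
    have b₂ : ((n : ℝ) + 1) * -M ≤ ((n : ℝ) + 1) * u x := mul_le_mul_of_nonneg_left hMx.1 hn.le
    have hmem : m ∈ Finset.Icc (-(N : ℤ)) N := by
      rw [Finset.mem_Icc]
      constructor
      · have : (-(N : ℝ)) ≤ m := by linarith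
        exact_mod_cast this
      · have : (m : ℝ) ≤ N := by linarith
        exact_mod_cast this
    rw [ContinuousMap.sum_apply, Finset.sum_eq_single m]
    · rw [ContinuousMap.smul_apply, (hx m).2 rfl, smul_eq_mul, mul_one,
        show (m : ℝ) / ((n : ℝ) + 1) - u x = (m - ((n : ℝ) + 1) * u x) / ((n : ℝ) + 1) by
          field_simp, abs_div, abs_of_pos hn]
      refine div_le_div_of_nonneg_right ?_ hn.le
      rw [abs_le]
      constructor <;> linarith
    · intro j _ hj
      rw [ContinuousMap.smul_apply, hx0 j hj.symm, smul_zero]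
    · exact fun h => absurd hmem h
  choose G hG using step
  have hall := eventually_countable_forall.2 hG
  have hlim : Tendsto (fun n : ℕ => 1 / ((n : ℝ) + 1)) atTop (𝓝 0) :=
    tendsto_one_div_add_atTop_nhds_zero_nat
  have hanti : ∀ {n N : ℕ}, N ≤ n → 1 / ((n : ℝ) + 1) ≤ 1 / ((N : ℝ) + 1) := fun h => by
    gcongr
  have hcauchy : CauchySeq G := by
    refine cauchySeq_of_le_tendsto_0 (fun N : ℕ => 1 / ((N : ℝ) + 1) + 1 / ((N : ℝ) + 1))
      (fun n m N hn hm => ?_) (by simpa using hlim.add hlim)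
    -- The estimate against `u` holds only off a meagre set, but between two continuous functions it
    -- extends everywhere, which makes `G` uniformly Cauchy.
    have hc : ∀ n m : ℕ, N ≤ n → N ≤ m →
        G n ≤ G m + (1 / ((N : ℝ) + 1) + 1 / ((N : ℝ) + 1)) • (1 : C(X, ℝ)) := by
      intro n m hn hm
      refine ContinuousMap.le_of_eventually_residual (hall.mono fun x hx => ?_)
      have h1 := abs_le.1 ((hx n).trans (hanti hn))
      have h2 := abs_le.1 ((hx m).trans (hanti hm))
      rw [ContinuousMap.add_apply, ContinuousMap.smul_apply, ContinuousMap.one_apply, smul_eq_mul,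
        mul_one]
      linarith [h1.2, h2.1]
    refine (ContinuousMap.dist_le (by positivity)).2 fun x => ?_
    have e₁ : G n x ≤ G m x + (1 / ((N : ℝ) + 1) + 1 / ((N : ℝ) + 1)) * 1 := hc n m hn hm x
    have e₂ : G m x ≤ G n x + (1 / ((N : ℝ) + 1) + 1 / ((N : ℝ) + 1)) * 1 := hc m n hm hn x
    rw [Real.dist_eq, abs_le]
    constructor <;> linarith
  obtain ⟨g, hg⟩ := cauchySeq_tendsto_of_complete hcauchy
  refine ⟨g, hall.mono fun x hx => ?_⟩
  have h1 : Tendsto (fun n => G n x) atTop (𝓝 (g x)) :=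
    ((continuous_eval_const x : Continuous fun k : C(X, ℝ) => k x).tendsto g).comp hg
  have h2 : Tendsto (fun n => G n x) atTop (𝓝 (u x)) := by
    rw [tendsto_iff_norm_sub_tendsto_zero]
    exact squeeze_zero (fun _ => norm_nonneg _) hx hlim
  exact tendsto_nhds_unique h1 h2

end FunctionRep

/-- The order criterion of `mem_range_iff` refers only to `CC(a)`, so it transfers membership from
one representation to another. -/
theorem spectrum_eq_range {A : Type u} [NormedAddCommGroup A] [NormedSpace ℝ A] [PartialOrder A]
    [IsOrderedAddMonoid A] [IsOrderedModule ℝ A] [One A] [OrderUnitSpace A]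
    {b : CompressionBase A} {a : A} {X : Type u} [TopologicalSpace X] [CompactSpace X]
    [T2Space X] [TotallyDisconnectedSpace X] {ι : C(X, ℝ) →ₗ[ℝ] A} {f : C(X, ℝ)}
    (hι : b.IsFunctionRep a ι) (hf : ι f = a) : b.spectrum a = Set.range f := by
  ext t
  constructor
  · rintro ⟨Y, _, _, _, _, κ, k, hκ, hk, ht⟩
    exact (hι.mem_range_iff hf t).2 ((hκ.mem_range_iff hk t).1 ht)
  · exact fun ht => ⟨X, _, ‹_›, ‹_›, ‹_›, ι, f, hι, hf, ht⟩

end CompressionBase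

/-! ### Assembly of the functional calculus -/

open CompressionBase

theorem theorem4p3 {A : Type u} [NormedAddCommGroup A] [NormedSpace ℝ A] [PartialOrder A]
    [IsOrderedAddMonoid A] [IsOrderedModule ℝ A] [One A] [OrderUnitSpace A] [CompleteSpace A]
    (b : CompressionBase A) (hb : b.IsSpectral) (a : A) :
    -- `CC(a)` is isomorphic to some `C(X, ℝ)`, and the spectrum is the range of the function
    -- corresponding to `a` in any such isomorphism
    (∃ (X : Type u) (_ : TopologicalSpace X) (_ : CompactSpace X) (_ : T2Space X)
      (_ : TotallyDisconnectedSpace X) (ι : C(X, ℝ) →ₗ[ℝ] A) (f : C(X, ℝ)),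
      b.IsFunctionRep a ι ∧ ι f = a) ∧
    (∀ (X : Type u) [TopologicalSpace X] [CompactSpace X] [T2Space X]
      [TotallyDisconnectedSpace X] (ι : C(X, ℝ) →ₗ[ℝ] A) (f : C(X, ℝ)),
      b.IsFunctionRep a ι → ι f = a → b.spectrum a = Set.range f) ∧
    -- the Borel functional calculus
    ∃ (Ψ : boundedBorel (b.spectrum a) →ₗ[ℝ] A) (hΨ : ∀ h, Ψ h ∈ b.bicommutant a),
      (∀ h : boundedBorel (b.spectrum a), (∀ t, 0 ≤ h.1 t) → 0 ≤ Ψ h) ∧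
      Ψ 1 = 1 ∧
      (∃ hid : (fun t : b.spectrum a => (t : ℝ)) ∈ boundedBorel (b.spectrum a),
        Ψ ⟨fun t => (t : ℝ), hid⟩ = a) ∧
      (∀ (B : Set (b.spectrum a)) (hB : MeasurableSet B),
        Ψ (boundedBorel.char B hB) ∈ b.projBicommutant a) ∧
      (∀ h₁ h₂ : boundedBorel (b.spectrum a),
        IsLUB ({⟨Ψ h₁, hΨ h₁⟩, ⟨Ψ h₂, hΨ h₂⟩} : Set (b.bicommutant a))
          ⟨Ψ (boundedBorel.max h₁ h₂), hΨ _⟩) ∧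
      (∀ (h' : ℕ → boundedBorel (b.spectrum a)) (h : boundedBorel (b.spectrum a)),
        (∀ n t, (h' n).1 t ≤ (h' (n + 1)).1 t) →
        (∀ t, IsLUB (Set.range fun n => (h' n).1 t) (h.1 t)) →
        IsLUB (Set.range fun n => (⟨Ψ (h' n), hΨ (h' n)⟩ : b.bicommutant a)) ⟨Ψ h, hΨ h⟩) := by
  have := compactSpace_bicommutantCharacters hb.2 a
  have := totallyDisconnectedSpace_bicommutantCharacters hb.2 a
  set X := b.bicommutantCharacters a
  have hι := isFunctionRep_gelfandInv hb.2 a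
  set ι := gelfandInv hb.2 a
  set aM : b.bicommutantSubmodule a :=
    ⟨a, (mem_bicommutantSubmodule hb.2).2 (self_mem_bicommutant a)⟩
  set f : C(X, ℝ) := b.gelfandMap a aM
  have hf : ι f = a := gelfandInv_gelfandMap hb.2 aM
  have hproj : ∀ g, ι g ∈ b.proj → ∀ x, g x = 0 ∨ g x = 1 := by
    intro g hg x
    obtain ⟨p, rfl⟩ := gelfandMap_surjective hb.2 g
    rw [show ι (b.gelfandMap a p) = p from gelfandInv_gelfandMap hb.2 p] at hg
    exact x.2.2 p hg
  have hspec : ∀ t : ℝ, ∃ g, ι g ∈ b.projBicommutant a ∧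
      ∀ x, (g x = 1 → t ≤ f x) ∧ (g x = 0 → f x ≤ t) := by
    intro t
    obtain ⟨p, hp, -, -, h⟩ := exists_projection_character hb.2 aM t
    refine ⟨b.gelfandMap a p, ?_, fun x => h x.1 x.2⟩
    rwa [show ι (b.gelfandMap a p) = p from gelfandInv_gelfandMap hb.2 p]
  have hsp : b.spectrum a = Set.range f := spectrum_eq_range hι hf
  refine ⟨⟨X, _, ‹_›, inferInstance, ‹_›, ι, f, hι, hf⟩,
    fun Y _ _ _ _ κ k hκ hk => spectrum_eq_range hκ hk, ?_⟩
  have hS : ∀ x, f x ∈ b.spectrum a := fun x => hsp ▸ ⟨x, rfl⟩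
  -- The choice is harmless: continuous representatives are unique by Baire's theorem, which also
  -- makes `G` linear.
  choose G hG using hι.exists_continuous_eq_comp hb hproj hspec hS
  let Ψ : boundedBorel (b.spectrum a) →ₗ[ℝ] A := ι ∘ₗ
    { toFun := G
      map_add' := fun g h => ContinuousMap.eq_of_eventually_residual (by
        filter_upwards [hG g, hG h, hG (g + h)] with x h₁ h₂ h₃
        rw [ContinuousMap.add_apply, h₁, h₂, h₃]
        rfl)
      map_smul' := fun t h => ContinuousMap.eq_of_eventually_residual (by
        filter_upwards [hG h, hG (t • h)] with x h₁ h₂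
        rw [RingHom.id_apply, ContinuousMap.smul_apply, h₁, h₂]
        rfl) }
  have hΨG : ∀ h, Ψ h = ι (G h) := fun _ => rfl
  have hΨ : ∀ h, Ψ h ∈ b.bicommutant a := fun h => hι.range_eq ▸ ⟨G h, rfl⟩
  have hmono : ∀ g h : boundedBorel (b.spectrum a), (∀ t, g.1 t ≤ h.1 t) → Ψ g ≤ Ψ h := by
    intro g h hgh
    rw [hΨG, hΨG, hι.le_iff_le]
    refine ContinuousMap.le_of_eventually_residual ?_
    filter_upwards [hG g, hG h] with x h₁ h₂
    rw [h₁, h₂]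
    exact hgh _
  refine ⟨Ψ, hΨ, fun h hh => ?_, ?_, ?_, fun B hB => ?_, fun h₁ h₂ => ⟨?_, ?_⟩,
    fun h' h _ hsup => ⟨?_, ?_⟩⟩
  · rw [← map_zero Ψ]
    exact hmono _ _ hh
  · have : G 1 = 1 := ContinuousMap.eq_of_eventually_residual ((hG 1).mono fun x hx => hx)
    rw [hΨG, this, hι.map_one]
  · refine ⟨⟨measurable_subtype_coe, ‖f‖, fun t => ?_⟩, ?_⟩
    · obtain ⟨x, hx⟩ : (t : ℝ) ∈ Set.range f := by rw [← hsp]; exact t.2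
      change |(t : ℝ)| ≤ _
      rw [← hx]
      exact f.norm_coe_le_norm x
    · exact (congrArg ι (ContinuousMap.eq_of_eventually_residual
        ((hG _).mono fun x hx => hx))).trans hf
  · obtain ⟨B', hB', rfl⟩ := id hB
    obtain ⟨g, hg, hgB⟩ := hι.exists_preimage hb hproj hspec B' hB'
    -- Off a meagre set both sides are the indicator of the preimage of `B'` under `f`.
    have : G (boundedBorel.char _ hB) = g := by
      refine ContinuousMap.eq_of_eventually_residual ?_
      filter_upwards [hgB, hG (boundedBorel.char _ hB)] with x h₁ h₂
      rw [h₂]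
      by_cases hx : f x ∈ B'
      · rw [h₁.2 hx]
        exact Set.indicator_of_mem (s := Subtype.val ⁻¹' B') (a := ⟨f x, hS x⟩) hx (fun _ => (1 : ℝ))
      · rw [(hproj g (mem_projBicommutant.1 hg).1 x).resolve_right fun e => hx (h₁.1 e)]
        exact Set.indicator_of_notMem (s := Subtype.val ⁻¹' B') (a := ⟨f x, hS x⟩) hx (fun _ => (1 : ℝ))
    rw [hΨG, this]
    exact hg
  · rintro _ (rfl | rfl)
    · exact hmono _ _ fun t => le_max_left _ _
    · exact hmono _ _ fun t => le_max_right _ _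
  · rintro ⟨y, hy⟩ hub
    obtain ⟨k, rfl⟩ := hι.range_eq.symm ▸ hy
    have u₁ : ι (G h₁) ≤ ι k := hub (Or.inl rfl)
    have u₂ : ι (G h₂) ≤ ι k := hub (Or.inr rfl)
    rw [hι.le_iff_le] at u₁ u₂
    change ι (G _) ≤ ι k
    rw [hι.le_iff_le]
    refine ContinuousMap.le_of_eventually_residual ?_
    filter_upwards [hG h₁, hG h₂, hG (boundedBorel.max h₁ h₂)] with x e₁ e₂ e₃
    rw [e₃]
    exact max_le (e₁ ▸ u₁ x) (e₂ ▸ u₂ x)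
  · rintro _ ⟨n, rfl⟩
    exact hmono _ _ fun t => (hsup t).1 ⟨n, rfl⟩
  · rintro ⟨y, hy⟩ hub
    obtain ⟨k, rfl⟩ := hι.range_eq.symm ▸ hy
    have hu : ∀ n, G (h' n) ≤ k := fun n => (hι.le_iff_le _ _).1 (hub ⟨n, rfl⟩)
    change ι (G _) ≤ ι k
    rw [hι.le_iff_le]
    refine ContinuousMap.le_of_eventually_residual ?_
    -- Countably many exceptional meagre sets are discarded at once; at the remaining points `k`
    -- bounds all values `h' n (f x)`, hence their supremum.
    filter_upwards [hG h, eventually_countable_forall.2 fun n => hG (h' n)] with x e₁ e₂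
    rw [e₁]
    refine (hsup _).2 ?_
    rintro _ ⟨n, rfl⟩
    exact (e₂ n).symm.trans_le (hu n x)
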